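/- Let $R,S$ be associative unital rings, not necessarily commutative, $\varphi:R\to S$ a ring homomorphism, $C$ an $R$-coring and $D$ an $S$-coring, with comultiplications $\Delta_C,\Delta_D$ and counits $\varepsilon_C,\varepsilon_D$. Let $(\Phi,\varphi)$ be a coring homomorphism from $C$ to $D$: $\Phi:C\to D$ is additive, $\Phi(rcr')=\varphi(r)\Phi(c)\varphi(r')$, $\Delta_D(\Phi(c))=\sum\Phi(c_{(1)})\otimes_S\Phi(c_{(2)})$ and $\varepsilon_D(\Phi(c))=\varphi(\varepsilon_C(c))$. Write $\mathcal M^C_R$, $\mathcal M^D_S$ for the categories of right comodules and right colinear maps. The induction functor $F=-\otimes_RS:\mathcal M^C_R\to\mathcal M^D_S$ equips $M\otimes_RS$ with the coaction $m\otimes s\mapsto\sum(m_{[0]}\otimes_R1)\otimes_S\Phi(m_{[1]})s$. The $(S,R)$-bimodule $S\otimes_RC$ has the left $D$-coaction $\lambda(s\otimes c)=\sum s\Phi(c_{(1)})\otimes_S(1\otimes_Rc_{(2)})$ and the right $C$-coaction $S\otimes_R\Delta_C$. For $N\in\mathcal M^D_S$ with coaction $\rho_N$, the cotensor product $N\,\square_D(S\otimes_RC)\subseteq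 N\otimes_S(S\otimes_RC)$ is the equalizer of the pair $$\rho_N\otimes_S(S\otimes_RC),\quad N\otimes_S\lambda\;:\;N\otimes_S(S\otimes_RC)\to N\otimes_SD\otimes_S(S\otimes_RC).\qquad(*_N)$$ A left (right) $R$-module preserves an equalizer $i:E\to X$ of maps $f,g:X\to Y$ of right (left) $R$-modules if tensoring with it over $R$ on that side turns $i$ into an equalizer of the tensored pair. Assume: 1. the left $R$-module $C\otimes_RC$ preserves the equalizer of $(*_N)$ for every $N\in\mathcal M^D_S$; 2. the right $R$-module $M$ preserves the equalizer of the pair $(*_{C\otimes_RS})$, regarded as a pair of maps of left $R$-modules, for every $M\in\mathcal M^C_R$. Put $GFC=(C\otimes_RS)\,\square_D(S\otimes_RC)$, with inclusion $i$ into $X=(C\otimes_RS)\otimes_S(S\otimes_RC)$. It is a $C$-bicomodule: its right (left) $C$-coaction is the unique map whose composite with $i\otimes_RC$ (with $C\otimes_Ri$) is the restriction to $GFC$ of the right (left) $C$-coaction of $X$ induced by $\Delta_C$ on the last (first) factor. Let $$\eta_C:C\to GFC,\qquad\eta_C(c)=\sum(c_{(1)}\otimes_R1)\otimes_S(1\otimes_Rc_{(2)}).$$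 Then $F$ is naturally full, i.e. there are maps $P_{M,M'}:\mathrm{Hom}_{\mathcal M^D_S}(FM,FM')\to\mathrm{Hom}_{\mathcal M^C_R}(M,M')$, natural in $M,M'\in\mathcal M^C_R$, with $F(P_{M,M'}(u))=u$ for all $u$, if and only if there is a homomorphism of $C$-bicomodules (an $R$-bimodule map that is left and right $C$-colinear) $\nu_C:GFC\to C$ such that $$\eta_C\circ\nu_C=\mathrm{id}_{GFC}.$$ -/

import Mathlib

/-!
Rings are associative and unital, not necessarily commutative.  A right `R`-module is a module over
`Rᵐᵒᵖ`, with `m <• r` for the right action; an `(A, B)`-bimodule is an abelian group with instances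
`Module A M`, `Module Bᵐᵒᵖ M` and `SMulCommClass A Bᵐᵒᵖ M`.
-/

open scoped RightActions

universe u

noncomputable section

/-! ### The balanced tensor product over a noncommutative ring -/

section BalTensorBasic

variable (R : Type*) [Ring R] (M N : Type*) [AddCommGroup M] [AddCommGroup N]
  [Module Rᵐᵒᵖ M] [Module R N]

/-- The relations `m r ⊗ n = m ⊗ r n`. -/
def BalTensor.rel : AddSubgroup (TensorProduct ℤ M N) :=
  AddSubgroup.closure
    {x | ∃ (m : M) (r : R) (n : N),
      x = TensorProduct.tmul ℤ (m <• r) n - TensorProduct.tmul ℤ m (r • n)}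

/-- The tensor product `M ⊗_R N` of a right `R`-module `M` and a left `R`-module `N`. -/
def BalTensor : Type _ := TensorProduct ℤ M N ⧸ BalTensor.rel R M N

instance BalTensor.instAddCommGroup : AddCommGroup (BalTensor R M N) :=
  inferInstanceAs (AddCommGroup (TensorProduct ℤ M N ⧸ BalTensor.rel R M N))

end BalTensorBasic

/-- `M ⊛[R] N` is the tensor product of a right and a left module over the ring `R`. -/
notation:100 M:100 " ⊛[" R "] " N:101 => BalTensor R M N

namespace BalTensor

section Api

variable {R : Type*} [Ring R] {M N P : Type*} [AddCommGroup M] [AddCommGroup N] [AddCommGroup P]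
  [Module Rᵐᵒᵖ M] [Module R N]

/-- The pure tensor `m ⊗_R n`. -/
def tmul (R : Type*) [Ring R] {M N : Type*} [AddCommGroup M] [AddCommGroup N]
    [Module Rᵐᵒᵖ M] [Module R N] (m : M) (n : N) : M ⊛[R] N :=
  QuotientAddGroup.mk (s := rel R M N) (TensorProduct.tmul ℤ m n)

theorem add_tmul (m m' : M) (n : N) : tmul R (m + m') n = tmul R m n + tmul R m' n :=
  congrArg (QuotientAddGroup.mk (s := rel R M N)) (TensorProduct.add_tmul m m' n)

theorem tmul_add (m : M) (n n' : N) : tmul R m (n + n') = tmul R m n + tmul R m n' :=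
  congrArg (QuotientAddGroup.mk (s := rel R M N)) (TensorProduct.tmul_add m n n')

theorem smul_tmul (m : M) (r : R) (n : N) : tmul R (m <• r) n = tmul R m (r • n) := by
  refine (QuotientAddGroup.eq_iff_sub_mem).2 ?_
  exact AddSubgroup.subset_closure ⟨m, r, n, rfl⟩

@[simp] theorem zero_tmul (n : N) : tmul R (0 : M) n = 0 :=
  congrArg (QuotientAddGroup.mk (s := rel R M N)) (TensorProduct.zero_tmul M n)

@[simp] theorem tmul_zero (m : M) : tmul R m (0 : N) = 0 :=
  congrArg (QuotientAddGroup.mk (s := rel R M N)) (TensorProduct.tmul_zero N m)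

theorem induction_on {p : M ⊛[R] N → Prop} (x : M ⊛[R] N) (h0 : p 0)
    (ht : ∀ m n, p (tmul R m n)) (ha : ∀ x y, p x → p y → p (x + y)) : p x := by
  obtain ⟨y, rfl⟩ := QuotientAddGroup.mk_surjective x
  induction y using TensorProduct.induction_on with
  | zero => exact h0
  | tmul m n => exact ht m n
  | add a b hx hy => exact ha _ _ hx hy

/-- The universal property: a balanced biadditive map factors through the tensor product. -/
def lift (f : M → N → P) (h₁ : ∀ m m' n, f (m + m') n = f m n + f m' n)
    (h₂ : ∀ m n n', f m (n + n') = f m n + f m n')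
    (h : ∀ m (r : R) n, f (m <• r) n = f m (r • n)) : M ⊛[R] N →+ P :=
  QuotientAddGroup.lift (rel R M N)
    (TensorProduct.liftAddHom
      (AddMonoidHom.mk' (fun m => AddMonoidHom.mk' (f m) (h₂ m))
        (fun m m' => AddMonoidHom.ext (h₁ m m')) : M →+ N →+ P)
      (fun z m n => by rw [map_zsmul, AddMonoidHom.zsmul_apply, ← map_zsmul])) (by
      rw [rel, AddSubgroup.closure_le]
      rintro _ ⟨m, r, n, rfl⟩
      simp [h])

@[simp] theorem lift_tmul (f : M → N → P) (h₁ : ∀ m m' n, f (m + m') n = f m n + f m' n)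
    (h₂ : ∀ m n n', f m (n + n') = f m n + f m n')
    (h : ∀ m (r : R) n, f (m <• r) n = f m (r • n))
    (m : M) (n : N) : lift f h₁ h₂ h (tmul R m n) = f m n := rfl

theorem addHom_ext {f g : M ⊛[R] N →+ P} (h : ∀ m n, f (tmul R m n) = g (tmul R m n)) : f = g := by
  ext x
  induction x using induction_on with
  | h0 => rw [_root_.map_zero, _root_.map_zero]
  | ht m n => exact h m n
  | ha x y hx hy => rw [_root_.map_add, _root_.map_add, hx, hy]

theorem addHom_congr {f g : M ⊛[R] N →+ P} (h : ∀ m n, f (tmul R m n) = g (tmul R m n))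
    (x : M ⊛[R] N) : f x = g x := by
  rw [addHom_ext h]

end Api

section MapSemi

variable {R S : Type*} [Ring R] [Ring S] {M N M' N' : Type*}
  [AddCommGroup M] [AddCommGroup N] [AddCommGroup M'] [AddCommGroup N']
  [Module Rᵐᵒᵖ M] [Module R N] [Module Sᵐᵒᵖ M'] [Module S N']

/-- For `φ : R → S` and additive maps `f`, `g` that are `R`-linear when the targets are regarded as
`R`-modules through `φ`: the map `M ⊗_R N → M' ⊗_S N'`, `m ⊗ n ↦ f m ⊗ g n`, which is `f ⊗_R g`
followed by the canonical projection `M' ⊗_R N' → M' ⊗_S N'`. -/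
def mapSemi (φ : R →+* S) (f : M →+ M') (g : N →+ N')
    (hf : ∀ (m : M) (r : R), f (m <• r) = f m <• φ r)
    (hg : ∀ (r : R) (n : N), g (r • n) = φ r • g n) : M ⊛[R] N →+ M' ⊛[S] N' :=
  lift (fun m n => tmul S (f m) (g n))
    (fun m m' n => by rw [_root_.map_add, add_tmul])
    (fun m n n' => by rw [_root_.map_add, tmul_add])
    (fun m r n => by rw [hf, hg, smul_tmul])

@[simp] theorem mapSemi_tmul (φ : R →+* S) (f : M →+ M') (g : N →+ N')
    (hf : ∀ (m : M) (r : R), f (m <• r) = f m <• φ r)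
    (hg : ∀ (r : R) (n : N), g (r • n) = φ r • g n) (m : M) (n : N) :
    mapSemi φ f g hf hg (tmul R m n) = tmul S (f m) (g n) := rfl

end MapSemi

section Map

variable {R : Type*} [Ring R] {M N M' N' : Type*}
  [AddCommGroup M] [AddCommGroup N] [AddCommGroup M'] [AddCommGroup N']
  [Module Rᵐᵒᵖ M] [Module R N] [Module Rᵐᵒᵖ M'] [Module R N']

/-- `f ⊗_R g` for a right `R`-linear map `f` and a left `R`-linear map `g`. -/
def map (f : M →ₗ[Rᵐᵒᵖ] M') (g : N →ₗ[R] N') : M ⊛[R] N →+ M' ⊛[R] N' :=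
  mapSemi (RingHom.id R) f.toAddMonoidHom g.toAddMonoidHom
    (fun m r => f.map_smul (MulOpposite.op r) m) (fun r n => g.map_smul r n)

@[simp] theorem map_tmul (f : M →ₗ[Rᵐᵒᵖ] M') (g : N →ₗ[R] N') (m : M) (n : N) :
    map f g (tmul R m n) = tmul R (f m) (g n) := rfl

end Map

section Actions

variable {R : Type*} [Ring R] {M N : Type*} [AddCommGroup M] [AddCommGroup N]
  [Module Rᵐᵒᵖ M] [Module R N]

/-- `m ⊗ n ↦ (a m) ⊗ n`. -/
def lsmulHom {A : Type*} [Ring A] [Module A M] [SMulCommClass A Rᵐᵒᵖ M] (a : A) :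
    M ⊛[R] N →+ M ⊛[R] N :=
  lift (fun m n => tmul R (a • m) n) (fun m m' n => by rw [smul_add, add_tmul])
    (fun m n n' => by rw [tmul_add]) (fun m r n => by rw [smul_comm, smul_tmul])

/-- `m ⊗ n ↦ m ⊗ (n b)`. -/
def rsmulHom {B : Type*} [Ring B] [Module Bᵐᵒᵖ N] [SMulCommClass R Bᵐᵒᵖ N] (b : Bᵐᵒᵖ) :
    M ⊛[R] N →+ M ⊛[R] N :=
  lift (fun m n => tmul R m (b • n)) (fun m m' n => by rw [add_tmul])
    (fun m n n' => by rw [smul_add, tmul_add]) (fun m r n => by rw [← smul_comm, smul_tmul])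

/-- The left action on `M ⊗_R N`: `a (m ⊗ n) = (a m) ⊗ n`. -/
instance instModuleLeft {A : Type*} [Ring A] [Module A M] [SMulCommClass A Rᵐᵒᵖ M] :
    Module A (M ⊛[R] N) where
  smul a x := lsmulHom a x
  one_smul x := addHom_congr (f := lsmulHom (1 : A)) (g := AddMonoidHom.id _)
    (fun m n => by simp [lsmulHom]) x
  mul_smul a b x := addHom_congr (f := lsmulHom (a * b)) (g := (lsmulHom a).comp (lsmulHom b))
    (fun m n => by simp [lsmulHom, mul_smul]) x
  smul_zero a := (lsmulHom a).map_zero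
  smul_add a x y := (lsmulHom a).map_add x y
  add_smul a b x := addHom_congr (f := lsmulHom (a + b)) (g := lsmulHom a + lsmulHom b)
    (fun m n => by simp [lsmulHom, add_smul, add_tmul]) x
  zero_smul x := addHom_congr (f := lsmulHom (0 : A)) (g := 0)
    (fun m n => by simp [lsmulHom]) x

/-- The right action on `M ⊗_R N`: `(m ⊗ n) b = m ⊗ (n b)`. -/
instance instModuleRight {B : Type*} [Ring B] [Module Bᵐᵒᵖ N] [SMulCommClass R Bᵐᵒᵖ N] :
    Module Bᵐᵒᵖ (M ⊛[R] N) where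
  smul b x := rsmulHom b x
  one_smul x := addHom_congr (f := rsmulHom (1 : Bᵐᵒᵖ)) (g := AddMonoidHom.id _)
    (fun m n => by simp [rsmulHom]) x
  mul_smul a b x := addHom_congr (f := rsmulHom (a * b)) (g := (rsmulHom a).comp (rsmulHom b))
    (fun m n => by simp [rsmulHom, mul_smul]) x
  smul_zero a := (rsmulHom a).map_zero
  smul_add a x y := (rsmulHom a).map_add x y
  add_smul a b x := addHom_congr (f := rsmulHom (a + b)) (g := rsmulHom a + rsmulHom b)
    (fun m n => by simp [rsmulHom, add_smul, tmul_add]) x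
  zero_smul x := addHom_congr (f := rsmulHom (0 : Bᵐᵒᵖ)) (g := 0)
    (fun m n => by simp [rsmulHom]) x

theorem lsmul_tmul {A : Type*} [Ring A] [Module A M] [SMulCommClass A Rᵐᵒᵖ M] (a : A) (m : M)
    (n : N) : a • tmul R m n = tmul R (a • m) n := rfl

theorem rsmul_tmul {B : Type*} [Ring B] [Module Bᵐᵒᵖ N] [SMulCommClass R Bᵐᵒᵖ N] (b : B) (m : M)
    (n : N) : (tmul R m n) <• b = tmul R m (n <• b) := rfl

instance instSMulCommClass {A B : Type*} [Ring A] [Ring B] [Module A M] [SMulCommClass A Rᵐᵒᵖ M]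
    [Module Bᵐᵒᵖ N] [SMulCommClass R Bᵐᵒᵖ N] : SMulCommClass A Bᵐᵒᵖ (M ⊛[R] N) where
  smul_comm a b x := by
    induction x using induction_on with
    | h0 => simp only [smul_zero]
    | ht m n => rfl
    | ha x y hx hy => simp only [smul_add, hx, hy]

end Actions

section Linearity

variable {R S : Type*} [Ring R] [Ring S] {M N M' N' : Type*}
  [AddCommGroup M] [AddCommGroup N] [AddCommGroup M'] [AddCommGroup N']
  [Module Rᵐᵒᵖ M] [Module R N] [Module Sᵐᵒᵖ M'] [Module S N']

theorem mapSemi_rsmul {B B' : Type*} [Ring B] [Ring B'] [Module Bᵐᵒᵖ N] [SMulCommClass R Bᵐᵒᵖ N]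
    [Module B'ᵐᵒᵖ N'] [SMulCommClass S B'ᵐᵒᵖ N'] (φ : R →+* S) (f : M →+ M') (g : N →+ N')
    (hf : ∀ (m : M) (r : R), f (m <• r) = f m <• φ r)
    (hg : ∀ (r : R) (n : N), g (r • n) = φ r • g n) (b : B) (b' : B')
    (h : ∀ n, g (n <• b) = g n <• b') (x : M ⊛[R] N) :
    mapSemi φ f g hf hg (x <• b) = mapSemi φ f g hf hg x <• b' := by
  induction x using induction_on with
  | h0 => simp
  | ht m n => simp only [rsmul_tmul, mapSemi_tmul, h]
  | ha x y hx hy => simp only [smul_add, map_add, hx, hy]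

theorem mapSemi_lsmul {A A' : Type*} [Ring A] [Ring A'] [Module A M] [SMulCommClass A Rᵐᵒᵖ M]
    [Module A' M'] [SMulCommClass A' Sᵐᵒᵖ M'] (φ : R →+* S) (f : M →+ M') (g : N →+ N')
    (hf : ∀ (m : M) (r : R), f (m <• r) = f m <• φ r)
    (hg : ∀ (r : R) (n : N), g (r • n) = φ r • g n) (a : A) (a' : A')
    (h : ∀ m, f (a • m) = a' • f m) (x : M ⊛[R] N) :
    mapSemi φ f g hf hg (a • x) = a' • mapSemi φ f g hf hg x := by
  induction x using induction_on with
  | h0 => simp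
  | ht m n => simp only [lsmul_tmul, mapSemi_tmul, h]
  | ha x y hx hy => simp only [smul_add, map_add, hx, hy]

end Linearity

section Linearity2

variable {R : Type*} [Ring R] {M N M' N' : Type*}
  [AddCommGroup M] [AddCommGroup N] [AddCommGroup M'] [AddCommGroup N']
  [Module Rᵐᵒᵖ M] [Module R N] [Module Rᵐᵒᵖ M'] [Module R N']

theorem map_rsmul {B : Type*} [Ring B] [Module Bᵐᵒᵖ N] [SMulCommClass R Bᵐᵒᵖ N]
    [Module Bᵐᵒᵖ N'] [SMulCommClass R Bᵐᵒᵖ N'] (f : M →ₗ[Rᵐᵒᵖ] M') (g : N →ₗ[R] N') (b : B)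
    (h : ∀ n, g (n <• b) = g n <• b) (x : M ⊛[R] N) : map f g (x <• b) = map f g x <• b :=
  mapSemi_rsmul _ _ _ _ _ b b h x

theorem map_lsmul {A : Type*} [Ring A] [Module A M] [SMulCommClass A Rᵐᵒᵖ M]
    [Module A M'] [SMulCommClass A Rᵐᵒᵖ M'] (f : M →ₗ[Rᵐᵒᵖ] M') (g : N →ₗ[R] N') (a : A)
    (h : ∀ m, f (a • m) = a • f m) (x : M ⊛[R] N) : map f g (a • x) = a • map f g x :=
  mapSemi_lsmul _ _ _ _ _ a a h x

/-- `f ⊗_R N` as a right linear map, for a bimodule `N`. -/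
def rTensor {B : Type*} [Ring B] (N : Type*) [AddCommGroup N] [Module R N] [Module Bᵐᵒᵖ N]
    [SMulCommClass R Bᵐᵒᵖ N] (f : M →ₗ[Rᵐᵒᵖ] M') : M ⊛[R] N →ₗ[Bᵐᵒᵖ] M' ⊛[R] N :=
  { map f (LinearMap.id : N →ₗ[R] N) with
    map_smul' := fun b x => map_rsmul f LinearMap.id b.unop (fun _ => rfl) x }

theorem map_comm (u : M →ₗ[Rᵐᵒᵖ] M') (v : N →ₗ[R] N') (x : M ⊛[R] N) :
    map u LinearMap.id (map LinearMap.id v x) = map LinearMap.id v (map u LinearMap.id x) :=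
  addHom_congr (f := (map u LinearMap.id).comp (map LinearMap.id v))
    (g := (map LinearMap.id v).comp (map u LinearMap.id)) (fun _ _ => rfl) x

end Linearity2

section Assoc

variable {R S : Type*} [Ring R] [Ring S] {M N P : Type*}
  [AddCommGroup M] [AddCommGroup N] [AddCommGroup P]
  [Module Rᵐᵒᵖ M] [Module R N] [Module Sᵐᵒᵖ N] [SMulCommClass R Sᵐᵒᵖ N] [Module S P]

/-- The map `(m ⊗ n) ⊗ p ↦ m ⊗ (n ⊗ p)`. -/
def assocHom (R S : Type*) [Ring R] [Ring S] (M N P : Type*)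
    [AddCommGroup M] [AddCommGroup N] [AddCommGroup P]
    [Module Rᵐᵒᵖ M] [Module R N] [Module Sᵐᵒᵖ N] [SMulCommClass R Sᵐᵒᵖ N] [Module S P] :
    (M ⊛[R] N) ⊛[S] P →+ M ⊛[R] (N ⊛[S] P) :=
  lift (fun x p => lift (fun m n => tmul R m (tmul S n p))
      (fun m m' n => by rw [add_tmul]) (fun m n n' => by rw [add_tmul, tmul_add])
      (fun m r n => by rw [smul_tmul, lsmul_tmul]) x)
    (fun x x' p => _root_.map_add _ x x')
    (fun x p p' => by
      induction x using induction_on with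
      | h0 => simp only [_root_.map_zero, add_zero]
      | ht m n => simp only [lift_tmul, tmul_add]
      | ha x y hx hy => simp only [_root_.map_add, hx, hy]; abel)
    (fun x s p => by
      induction x using induction_on with
      | h0 => simp only [_root_.map_zero, smul_zero]
      | ht m n => simp only [rsmul_tmul, lift_tmul, smul_tmul]
      | ha x y hx hy => simp only [smul_add, _root_.map_add, hx, hy])

/-- The map `m ⊗ (n ⊗ p) ↦ (m ⊗ n) ⊗ p`. -/
def assocInv (R S : Type*) [Ring R] [Ring S] (M N P : Type*)
    [AddCommGroup M] [AddCommGroup N] [AddCommGroup P]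
    [Module Rᵐᵒᵖ M] [Module R N] [Module Sᵐᵒᵖ N] [SMulCommClass R Sᵐᵒᵖ N] [Module S P] :
    M ⊛[R] (N ⊛[S] P) →+ (M ⊛[R] N) ⊛[S] P :=
  lift (fun m x => lift (fun n p => tmul S (tmul R m n) p)
      (fun n n' p => by rw [tmul_add, add_tmul]) (fun n p p' => by rw [tmul_add])
      (fun n s p => by rw [← rsmul_tmul, smul_tmul]) x)
    (fun m m' x => by
      induction x using induction_on with
      | h0 => simp only [_root_.map_zero, add_zero]
      | ht n p => simp only [lift_tmul, add_tmul]
      | ha x y hx hy => simp only [_root_.map_add, hx, hy]; abel)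
    (fun m x x' => _root_.map_add _ x x')
    (fun m r x => by
      induction x using induction_on with
      | h0 => simp only [_root_.map_zero, smul_zero]
      | ht n p => simp only [lsmul_tmul, lift_tmul, smul_tmul]
      | ha x y hx hy => simp only [smul_add, _root_.map_add, hx, hy])

@[simp] theorem assocHom_tmul (m : M) (n : N) (p : P) :
    assocHom R S M N P (tmul S (tmul R m n) p) = tmul R m (tmul S n p) := by
  rfl

@[simp] theorem assocInv_tmul (m : M) (n : N) (p : P) :
    assocInv R S M N P (tmul R m (tmul S n p)) = tmul S (tmul R m n) p := by
  rfl

theorem addHom_ext₃ {Q : Type*} [AddCommGroup Q] {f g : (M ⊛[R] N) ⊛[S] P →+ Q}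
    (h : ∀ m n p, f (tmul S (tmul R m n) p) = g (tmul S (tmul R m n) p)) : f = g := by
  refine addHom_ext fun x p => ?_
  induction x using induction_on with
  | h0 => simp
  | ht m n => exact h m n p
  | ha x y hx hy => simp only [add_tmul, map_add, hx, hy]

theorem addHom_ext₃' {Q : Type*} [AddCommGroup Q] {f g : M ⊛[R] (N ⊛[S] P) →+ Q}
    (h : ∀ m n p, f (tmul R m (tmul S n p)) = g (tmul R m (tmul S n p))) : f = g := by
  refine addHom_ext fun m x => ?_
  induction x using induction_on with
  | h0 => simp
  | ht n p => exact h m n p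
  | ha x y hx hy => simp only [tmul_add, map_add, hx, hy]

/-- The associativity isomorphism `(M ⊗_R N) ⊗_S P ≅ M ⊗_R (N ⊗_S P)`. -/
def assoc (R S : Type*) [Ring R] [Ring S] (M N P : Type*)
    [AddCommGroup M] [AddCommGroup N] [AddCommGroup P]
    [Module Rᵐᵒᵖ M] [Module R N] [Module Sᵐᵒᵖ N] [SMulCommClass R Sᵐᵒᵖ N] [Module S P] :
    (M ⊛[R] N) ⊛[S] P ≃+ M ⊛[R] (N ⊛[S] P) :=
  AddMonoidHom.toAddEquiv (assocHom R S M N P) (assocInv R S M N P)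
    (addHom_ext₃ (by simp)) (addHom_ext₃' (by simp))

@[simp] theorem assoc_tmul (m : M) (n : N) (p : P) :
    assoc R S M N P (tmul S (tmul R m n) p) = tmul R m (tmul S n p) := assocHom_tmul m n p

@[simp] theorem assoc_symm_tmul (m : M) (n : N) (p : P) :
    (assoc R S M N P).symm (tmul R m (tmul S n p)) = tmul S (tmul R m n) p := assocInv_tmul m n p

theorem assoc_rsmul {B : Type*} [Ring B] [Module Bᵐᵒᵖ P] [SMulCommClass S Bᵐᵒᵖ P] (b : B)
    (x : (M ⊛[R] N) ⊛[S] P) : assoc R S M N P (x <• b) = assoc R S M N P x <• b :=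
  DFunLike.congr_fun (addHom_ext₃
    (f := (assoc R S M N P).toAddMonoidHom.comp (rsmulHom (MulOpposite.op b)))
    (g := (rsmulHom (MulOpposite.op b)).comp (assoc R S M N P).toAddMonoidHom)
    fun _ _ _ => rfl) x

theorem assoc_lsmul {A : Type*} [Ring A] [Module A M] [SMulCommClass A Rᵐᵒᵖ M] (a : A)
    (x : (M ⊛[R] N) ⊛[S] P) : assoc R S M N P (a • x) = a • assoc R S M N P x :=
  DFunLike.congr_fun (addHom_ext₃
    (f := (assoc R S M N P).toAddMonoidHom.comp (lsmulHom a))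
    (g := (lsmulHom a).comp (assoc R S M N P).toAddMonoidHom)
    fun _ _ _ => rfl) x

theorem assoc_symm_rsmul {B : Type*} [Ring B] [Module Bᵐᵒᵖ P] [SMulCommClass S Bᵐᵒᵖ P] (b : B)
    (x : M ⊛[R] (N ⊛[S] P)) :
    (assoc R S M N P).symm (x <• b) = (assoc R S M N P).symm x <• b := by
  rw [AddEquiv.symm_apply_eq, assoc_rsmul, AddEquiv.apply_symm_apply]

theorem assoc_symm_lsmul {A : Type*} [Ring A] [Module A M] [SMulCommClass A Rᵐᵒᵖ M] (a : A)
    (x : M ⊛[R] (N ⊛[S] P)) :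
    (assoc R S M N P).symm (a • x) = a • (assoc R S M N P).symm x := by
  rw [AddEquiv.symm_apply_eq, assoc_lsmul, AddEquiv.apply_symm_apply]

end Assoc

section Units

variable (R : Type*) [Ring R] (M N : Type*) [AddCommGroup M] [AddCommGroup N]
  [Module Rᵐᵒᵖ M] [Module R N]

/-- The canonical map `R ⊗_R N → N`, `r ⊗ n ↦ r n`. -/
def lid : R ⊛[R] N →+ N :=
  lift (fun r n => r • n) (fun _ _ _ => add_smul _ _ _) (fun _ _ _ => smul_add _ _ _)
    (fun _ _ _ => mul_smul _ _ _)

/-- The canonical map `M ⊗_R R → M`, `m ⊗ r ↦ m r`. -/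
def rid : M ⊛[R] R →+ M :=
  lift (fun m r => m <• r) (fun _ _ _ => smul_add _ _ _)
    (fun _ _ _ => by rw [MulOpposite.op_add, add_smul])
    (fun _ _ _ => by rw [smul_eq_mul, MulOpposite.op_mul, mul_smul])

variable {R M N}

@[simp] theorem lid_tmul (r : R) (n : N) : lid R N (tmul R r n) = r • n := rfl

@[simp] theorem rid_tmul (m : M) (r : R) : rid R M (tmul R m r) = m <• r := rfl

end Units

end BalTensor

open BalTensor

/-! ### Bimodule maps -/

/-- Maps of `(A, B)`-bimodules. -/
structure BimodHom (A B : Type*) [Ring A] [Ring B] (M N : Type*) [AddCommGroup M] [AddCommGroup N]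
    [Module A M] [Module Bᵐᵒᵖ M] [Module A N] [Module Bᵐᵒᵖ N] where
  toFun : M →+ N
  map_lsmul : ∀ (a : A) (m : M), toFun (a • m) = a • toFun m
  map_rsmul : ∀ (m : M) (b : B), toFun (m <• b) = toFun m <• b

namespace BimodHom

variable {A B : Type*} [Ring A] [Ring B] {M N : Type*} [AddCommGroup M] [AddCommGroup N]
    [Module A M] [Module Bᵐᵒᵖ M] [Module A N] [Module Bᵐᵒᵖ N]

instance : CoeFun (BimodHom A B M N) (fun _ => M → N) := ⟨fun f => f.toFun⟩

/-- The underlying map of left modules. -/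
def left (f : BimodHom A B M N) : M →ₗ[A] N := { f.toFun with map_smul' := f.map_lsmul }

/-- The underlying map of right modules. -/
def right (f : BimodHom A B M N) : M →ₗ[Bᵐᵒᵖ] N :=
  { f.toFun with map_smul' := fun b m => f.map_rsmul m b.unop }

@[simp] theorem left_apply (f : BimodHom A B M N) (m : M) : f.left m = f m := rfl

@[simp] theorem right_apply (f : BimodHom A B M N) (m : M) : f.right m = f m := rfl

end BimodHom

/-! ### Corings and their right comodules -/

/-- An `R`-coring structure on the `R`-bimodule `C`. -/
class Coring (R : Type*) [Ring R] (C : Type*) [AddCommGroup C] [Module R C] [Module Rᵐᵒᵖ C]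
    [SMulCommClass R Rᵐᵒᵖ C] where
  comul : BimodHom R R C (C ⊛[R] C)
  counit : BimodHom R R C R
  coassoc : ∀ c, assoc R R C C C (map comul.right LinearMap.id (comul c)) =
    map LinearMap.id comul.left (comul c)
  counit_comul : ∀ c, lid R C (map counit.right LinearMap.id (comul c)) = c
  comul_counit : ∀ c, rid R C (map LinearMap.id counit.left (comul c)) = c

/-- A right `C`-comodule for an `R`-coring `C`. -/
structure RightComodule (R : Type u) [Ring R] (C : Type u) [AddCommGroup C] [Module R C]
    [Module Rᵐᵒᵖ C] [SMulCommClass R Rᵐᵒᵖ C] [Coring R C] where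
  carrier : Type u
  [addCommGroup : AddCommGroup carrier]
  [module : Module Rᵐᵒᵖ carrier]
  coact : carrier →ₗ[Rᵐᵒᵖ] carrier ⊛[R] C
  coassoc : ∀ m, assoc R R carrier C C (map coact LinearMap.id (coact m)) =
    map LinearMap.id (Coring.comul (R := R)).left (coact m)
  counit : ∀ m, rid R carrier (map LinearMap.id (Coring.counit (R := R) (C := C)).left (coact m)) = m

namespace RightComodule

variable {R : Type u} [Ring R] {C : Type u} [AddCommGroup C] [Module R C]
    [Module Rᵐᵒᵖ C] [SMulCommClass R Rᵐᵒᵖ C] [Coring R C]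

instance : CoeSort (RightComodule R C) (Type u) := ⟨carrier⟩

attribute [instance] addCommGroup module

/-- Right `C`-colinear maps. -/
@[ext] structure Hom (M N : RightComodule R C) where
  toLinearMap : M →ₗ[Rᵐᵒᵖ] N
  colinear : ∀ m, N.coact (toLinearMap m) = map toLinearMap LinearMap.id (M.coact m)

/-- The category of right `C`-comodules and right `C`-colinear maps. -/
instance : CategoryTheory.Category (RightComodule R C) where
  Hom := Hom
  id M := ⟨LinearMap.id, fun m =>
    (addHom_congr (f := AddMonoidHom.id _) (fun a b => by simp) (M.coact m))⟩
  comp {M N P} f g := ⟨g.toLinearMap.comp f.toLinearMap, fun m => by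
    rw [LinearMap.comp_apply, g.colinear, f.colinear]
    exact addHom_congr (f := (map g.toLinearMap LinearMap.id).comp
      (map f.toLinearMap LinearMap.id)) (fun a b => by simp) (M.coact m)⟩

/-- `C` as a right comodule over itself. -/
def self (R : Type u) [Ring R] (C : Type u) [AddCommGroup C] [Module R C]
    [Module Rᵐᵒᵖ C] [SMulCommClass R Rᵐᵒᵖ C] [Coring R C] : RightComodule R C where
  carrier := C
  coact := Coring.comul.right
  coassoc := Coring.coassoc
  counit := Coring.comul_counit

end RightComodule

/-! ### Restriction of scalars on the ring `S` -/

section Restrict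

variable {R S : Type*} [Ring R] [Ring S]

/-- `S` as an `(R, S)`-bimodule through `φ : R → S`. -/
def LeftRes (_φ : R →+* S) : Type _ := S

/-- `S` as an `(S, R)`-bimodule through `φ : R → S`. -/
def RightRes (_φ : R →+* S) : Type _ := S

variable (φ : R →+* S)

instance : AddCommGroup (LeftRes φ) := inferInstanceAs (AddCommGroup S)
instance : AddCommGroup (RightRes φ) := inferInstanceAs (AddCommGroup S)
instance : Module Sᵐᵒᵖ (LeftRes φ) := inferInstanceAs (Module Sᵐᵒᵖ S)
instance : Module S (RightRes φ) := inferInstanceAs (Module S S)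
instance : Module R (LeftRes φ) := Module.compHom S φ
instance : Module Rᵐᵒᵖ (RightRes φ) := Module.compHom S φ.op

/-- An element of `S`, regarded in the `(R, S)`-bimodule `S`. -/
def LeftRes.of : S ≃+ LeftRes φ := AddEquiv.refl S

/-- An element of `S`, regarded in the `(S, R)`-bimodule `S`. -/
def RightRes.of : S ≃+ RightRes φ := AddEquiv.refl S

theorem LeftRes.smul_of (r : R) (s : S) : r • LeftRes.of φ s = LeftRes.of φ (φ r * s) := rfl

theorem LeftRes.of_smul (s t : S) : LeftRes.of φ s <• t = LeftRes.of φ (s * t) := rfl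

theorem RightRes.smul_of (t s : S) : t • RightRes.of φ s = RightRes.of φ (t * s) := rfl

theorem RightRes.of_smul (s : S) (r : R) : RightRes.of φ s <• r = RightRes.of φ (s * φ r) := rfl

instance : SMulCommClass R Sᵐᵒᵖ (LeftRes φ) :=
  ⟨fun r t s => (mul_assoc (φ r) (s : S) t.unop).symm⟩

instance : SMulCommClass S Rᵐᵒᵖ (RightRes φ) :=
  ⟨fun t r s => (mul_assoc t (s : S) (φ r.unop)).symm⟩

end Restrict

/-! ### Homomorphisms of corings -/

/-- A coring homomorphism `(Φ, φ)` from the `R`-coring `C` to the `S`-coring `D`. -/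
structure CoringHom {R S : Type*} [Ring R] [Ring S] (φ : R →+* S) (C D : Type*)
    [AddCommGroup C] [Module R C] [Module Rᵐᵒᵖ C] [SMulCommClass R Rᵐᵒᵖ C] [Coring R C]
    [AddCommGroup D] [Module S D] [Module Sᵐᵒᵖ D] [SMulCommClass S Sᵐᵒᵖ D] [Coring S D] where
  toFun : C →+ D
  map_lsmul : ∀ (r : R) (c : C), toFun (r • c) = φ r • toFun c
  map_rsmul : ∀ (c : C) (r : R), toFun (c <• r) = toFun c <• φ r
  comul : ∀ c, mapSemi φ toFun toFun map_rsmul map_lsmul (Coring.comul (R := R) c) =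
    Coring.comul (R := S) (toFun c)
  counit : ∀ c, φ (Coring.counit (R := R) c) = Coring.counit (R := S) (toFun c)

namespace CoringHom

variable {R S : Type*} [Ring R] [Ring S] {φ : R →+* S} {C D : Type*}
  [AddCommGroup C] [Module R C] [Module Rᵐᵒᵖ C] [SMulCommClass R Rᵐᵒᵖ C] [Coring R C]
  [AddCommGroup D] [Module S D] [Module Sᵐᵒᵖ D] [SMulCommClass S Sᵐᵒᵖ D] [Coring S D]
  (Φ : CoringHom φ C D)

section Induction

variable {M : Type*} [AddCommGroup M] [Module Rᵐᵒᵖ M]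

/-- The map `M → M ⊗_R S`, `m ↦ m ⊗ 1`. -/
def tmulOne (φ : R →+* S) (M : Type*) [AddCommGroup M] [Module Rᵐᵒᵖ M] :
    M →+ M ⊛[R] LeftRes φ :=
  AddMonoidHom.mk' (fun m => tmul R m (LeftRes.of φ 1)) (fun _ _ => add_tmul _ _ _)

@[simp] theorem tmulOne_apply (m : M) : tmulOne φ M m = tmul R m (LeftRes.of φ 1) := rfl

theorem tmulOne_rsmul (m : M) (r : R) : tmulOne φ M (m <• r) = tmulOne φ M m <• φ r := by
  simp only [tmulOne_apply, smul_tmul, rsmul_tmul, LeftRes.smul_of, LeftRes.of_smul, one_mul,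
    mul_one]

/-- The map `M ⊗_R C → (M ⊗_R S) ⊗_S D`, `m ⊗ c ↦ (m ⊗ 1) ⊗ Φ c`. -/
def extend (M : Type*) [AddCommGroup M] [Module Rᵐᵒᵖ M] :
    M ⊛[R] C →+ (M ⊛[R] LeftRes φ) ⊛[S] D :=
  mapSemi φ (tmulOne φ M) Φ.toFun tmulOne_rsmul Φ.map_lsmul

@[simp] theorem extend_tmul (m : M) (c : C) :
    Φ.extend M (tmul R m c) = tmul S (tmul R m (LeftRes.of φ 1)) (Φ.toFun c) := by
  simp [extend]

theorem extend_rsmul (x : M ⊛[R] C) (r : R) : Φ.extend M (x <• r) = Φ.extend M x <• φ r :=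
  mapSemi_rsmul _ _ _ _ _ r (φ r) (fun c => Φ.map_rsmul c r) x

/-- The right `D`-coaction of `M ⊗_R S`: `m ⊗ s ↦ (m₀ ⊗ 1) ⊗ Φ(m₁) s`, for a right `C`-coaction
`ρ` on `M`. -/
def indCoact (ρ : M →ₗ[Rᵐᵒᵖ] M ⊛[R] C) :
    M ⊛[R] LeftRes φ →ₗ[Sᵐᵒᵖ] (M ⊛[R] LeftRes φ) ⊛[S] D :=
  { lift (R := R) (fun m (s : LeftRes φ) => Φ.extend M (ρ m) <• ((LeftRes.of φ).symm s))
      (fun m m' s => by rw [_root_.map_add, _root_.map_add, smul_add])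
      (fun m s s' => by rw [_root_.map_add, MulOpposite.op_add, add_smul])
      (fun m r s => by
        obtain ⟨s, rfl⟩ := (LeftRes.of φ).surjective s
        have h : ρ (m <• r) = ρ m <• r := ρ.map_smul _ _
        simp only [h, extend_rsmul, LeftRes.smul_of,
          AddEquiv.symm_apply_apply, MulOpposite.op_mul, mul_smul]) with
    map_smul' := fun t x => by
      obtain ⟨t, rfl⟩ := MulOpposite.op_surjective t
      induction x using induction_on with
      | h0 => simp
      | ht m s =>
        obtain ⟨s, rfl⟩ := (LeftRes.of φ).surjective s
        simp [rsmul_tmul, LeftRes.of_smul, mul_smul]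
      | ha x y hx hy =>
        simp only [ZeroHom.toFun_eq_coe, AddMonoidHom.toZeroHom_coe] at hx hy ⊢
        simp only [smul_add, map_add, hx, hy] }

@[simp] theorem indCoact_tmul (ρ : M →ₗ[Rᵐᵒᵖ] M ⊛[R] C) (m : M) (s : S) :
    Φ.indCoact ρ (tmul R m (LeftRes.of φ s)) = Φ.extend M (ρ m) <• s := by
  rfl

theorem indCoact_lsmul {A : Type*} [Ring A] [Module A M] [SMulCommClass A Rᵐᵒᵖ M]
    (ρ : M →ₗ[Rᵐᵒᵖ] M ⊛[R] C) (h : ∀ (a : A) m, ρ (a • m) = a • ρ m) (a : A)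
    (x : M ⊛[R] LeftRes φ) : Φ.indCoact ρ (a • x) = a • Φ.indCoact ρ x := by
  induction x using induction_on with
  | h0 => simp
  | ht m s =>
    obtain ⟨s, rfl⟩ := (LeftRes.of φ).surjective s
    rw [lsmul_tmul, indCoact_tmul, indCoact_tmul, h, smul_comm a]
    congr 1
    exact mapSemi_lsmul _ _ _ _ _ a a (fun m => (lsmul_tmul a m _).symm) _
  | ha x y hx hy => simp only [smul_add, map_add, hx, hy]

theorem indCoact_one (ρ : M →ₗ[Rᵐᵒᵖ] M ⊛[R] C) (m : M) :
    Φ.indCoact ρ (tmul R m (LeftRes.of φ 1)) = Φ.extend M (ρ m) := by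
  rw [indCoact_tmul, MulOpposite.op_one, one_smul]

theorem indCoact_counit (ρ : M →ₗ[Rᵐᵒᵖ] M ⊛[R] C)
    (h : ∀ m, rid R M (map LinearMap.id (Coring.counit (R := R) (C := C)).left (ρ m)) = m)
    (x : M ⊛[R] LeftRes φ) :
    rid S _ (map LinearMap.id (Coring.counit (R := S) (C := D)).left (Φ.indCoact ρ x)) = x := by
  have key : ∀ (y : M ⊛[R] C) (s : S),
      rid S _ (map LinearMap.id (Coring.counit (R := S) (C := D)).left (Φ.extend M y <• s)) =
      tmulOne φ M (rid R M (map LinearMap.id (Coring.counit (R := R) (C := C)).left y)) <• s := by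
    intro y s
    induction y using induction_on with
    | h0 => simp only [map_zero, smul_zero]
    | ht m c =>
      rw [extend_tmul, rsmul_tmul, map_tmul, rid_tmul, map_tmul, rid_tmul, LinearMap.id_apply,
        LinearMap.id_apply, BimodHom.left_apply, BimodHom.left_apply, tmulOne_rsmul, Φ.counit,
        BimodHom.map_rsmul, tmulOne_apply, smul_smul]
      rfl
    | ha x y hx hy => simp only [map_add, smul_add, hx, hy]
  induction x using induction_on with
  | h0 => simp only [map_zero]
  | ht m s =>
    obtain ⟨s, rfl⟩ := (LeftRes.of φ).surjective s
    rw [indCoact_tmul, key, h, tmulOne_apply, rsmul_tmul, LeftRes.of_smul, one_mul]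
  | ha x y hx hy => simp only [map_add, hx, hy]

theorem indCoact_coassoc (ρ : M →ₗ[Rᵐᵒᵖ] M ⊛[R] C)
    (h : ∀ m, assoc R R M C C (map ρ LinearMap.id (ρ m)) =
      map LinearMap.id (Coring.comul (R := R)).left (ρ m))
    (x : M ⊛[R] LeftRes φ) :
    assoc S S _ D D (map (Φ.indCoact ρ) LinearMap.id (Φ.indCoact ρ x)) =
      map LinearMap.id (Coring.comul (R := S)).left (Φ.indCoact ρ x) := by
  let T : M ⊛[R] (C ⊛[R] C) →+ (M ⊛[R] LeftRes φ) ⊛[S] (D ⊛[S] D) :=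
    mapSemi φ (tmulOne φ M) (mapSemi φ Φ.toFun Φ.toFun Φ.map_rsmul Φ.map_lsmul) tmulOne_rsmul
      (fun r y => mapSemi_lsmul _ _ _ _ _ r (φ r) (Φ.map_lsmul r) y)
  have keyA : ∀ (y : M ⊛[R] C),
      assoc S S _ D D (map (Φ.indCoact ρ) LinearMap.id (Φ.extend M y)) =
      T (assoc R R M C C (map ρ LinearMap.id y)) := by
    intro y
    induction y using induction_on with
    | h0 => simp only [map_zero]
    | ht m c =>
      rw [extend_tmul, map_tmul, map_tmul, indCoact_one]
      generalize ρ m = z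
      induction z using induction_on with
      | h0 => simp only [map_zero, zero_tmul]
      | ht m b => rfl
      | ha x y hx hy => simp only [map_add, add_tmul, hx, hy]
    | ha x y hx hy => simp only [map_add, hx, hy]
  have keyB : ∀ (y : M ⊛[R] C),
      map LinearMap.id (Coring.comul (R := S)).left (Φ.extend M y) =
      T (map LinearMap.id (Coring.comul (R := R)).left y) := by
    intro y
    induction y using induction_on with
    | h0 => simp only [map_zero]
    | ht m c =>
      rw [extend_tmul, map_tmul, map_tmul, BimodHom.left_apply, ← Φ.comul]
      rfl
    | ha x y hx hy => simp only [map_add, hx, hy]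
  induction x using induction_on with
  | h0 => simp only [map_zero]
  | ht m s =>
    obtain ⟨s, rfl⟩ := (LeftRes.of φ).surjective s
    rw [indCoact_tmul, BalTensor.map_rsmul _ _ _ (fun _ => rfl), assoc_rsmul, keyA, h, ← keyB,
      BalTensor.map_rsmul _ _ _ (fun d => Coring.comul.map_rsmul d s)]
  | ha x y hx hy => simp only [map_add, hx, hy]

theorem indCoact_natural {N : Type*} [AddCommGroup N] [Module Rᵐᵒᵖ N]
    (ρ : M →ₗ[Rᵐᵒᵖ] M ⊛[R] C) (σ : N →ₗ[Rᵐᵒᵖ] N ⊛[R] C) (f : M →ₗ[Rᵐᵒᵖ] N)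
    (h : ∀ m, σ (f m) = map f LinearMap.id (ρ m)) (x : M ⊛[R] LeftRes φ) :
    Φ.indCoact σ (rTensor (B := S) (LeftRes φ) f x) =
      map (rTensor (B := S) (LeftRes φ) f) LinearMap.id (Φ.indCoact ρ x) := by
  have key : ∀ y : M ⊛[R] C, Φ.extend N (map f LinearMap.id y) =
      map (rTensor (B := S) (LeftRes φ) f) LinearMap.id (Φ.extend M y) :=
    fun y => addHom_congr (f := (Φ.extend N).comp (map f LinearMap.id))
      (g := (map (rTensor (B := S) (LeftRes φ) f) LinearMap.id).comp (Φ.extend M)) (fun _ _ => rfl) y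
  induction x using induction_on with
  | h0 => simp only [map_zero]
  | ht m s =>
    obtain ⟨s, rfl⟩ := (LeftRes.of φ).surjective s
    change Φ.indCoact σ (tmul R (f m) (LeftRes.of φ s)) = _
    rw [indCoact_tmul, indCoact_tmul, BalTensor.map_rsmul _ _ _ (fun _ => rfl), h, key]
  | ha x y hx hy => simp only [map_add, hx, hy]

end Induction

section Bicomodule

/-- The `(S, R)`-bimodule `S ⊗_R C`. -/
abbrev Ext (_Φ : CoringHom φ C D) : Type _ := RightRes φ ⊛[R] C

/-- The map `C → S ⊗_R C`, `c ↦ 1 ⊗ c`. -/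
def oneTmul (Φ : CoringHom φ C D) : C →+ Φ.Ext :=
  AddMonoidHom.mk' (fun c => tmul R (RightRes.of φ 1) c) (fun _ _ => tmul_add _ _ _)

@[simp] theorem oneTmul_apply (c : C) : Φ.oneTmul c = tmul R (RightRes.of φ 1) c := rfl

theorem oneTmul_lsmul (r : R) (c : C) : Φ.oneTmul (r • c) = φ r • Φ.oneTmul c := by
  simp only [oneTmul_apply, ← smul_tmul, lsmul_tmul, RightRes.smul_of, RightRes.of_smul, one_mul,
    mul_one]

/-- The map `C ⊗_R C → D ⊗_S (S ⊗_R C)`, `c ⊗ c' ↦ Φ c ⊗ (1 ⊗ c')`. -/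
def extendLeft : C ⊛[R] C →+ D ⊛[S] Φ.Ext :=
  mapSemi φ Φ.toFun Φ.oneTmul Φ.map_rsmul Φ.oneTmul_lsmul

theorem extendLeft_lsmul (r : R) (x : C ⊛[R] C) :
    Φ.extendLeft (r • x) = φ r • Φ.extendLeft x :=
  mapSemi_lsmul _ _ _ _ _ r (φ r) (fun c => Φ.map_lsmul r c) x

theorem extendLeft_rsmul (x : C ⊛[R] C) (r : R) : Φ.extendLeft (x <• r) = Φ.extendLeft x <• r :=
  mapSemi_rsmul _ _ _ _ _ r r (fun _ => rfl) x

/-- The left `D`-coaction of `S ⊗_R C`: `s ⊗ c ↦ s Φ(c₁) ⊗ (1 ⊗ c₂)`. -/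
def extLeftCoact : BimodHom S R Φ.Ext (D ⊛[S] Φ.Ext) where
  toFun := lift (R := R)
    (fun (s : RightRes φ) c =>
      (RightRes.of φ).symm s • Φ.extendLeft (Coring.comul (R := R) c))
    (fun s s' c => by rw [map_add, add_smul])
    (fun s c c' => by rw [map_add, map_add, smul_add])
    (fun s r c => by
      obtain ⟨s, rfl⟩ := (RightRes.of φ).surjective s
      rw [BimodHom.map_lsmul, extendLeft_lsmul, RightRes.of_smul, AddEquiv.symm_apply_apply,
        AddEquiv.symm_apply_apply, mul_smul])
  map_lsmul a x := by
    induction x using induction_on with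
    | h0 => simp only [map_zero, smul_zero]
    | ht s c =>
      obtain ⟨s, rfl⟩ := (RightRes.of φ).surjective s
      rw [lsmul_tmul, lift_tmul, lift_tmul, RightRes.smul_of, AddEquiv.symm_apply_apply,
        AddEquiv.symm_apply_apply, mul_smul]
    | ha x y hx hy => simp only [map_add, smul_add, hx, hy]
  map_rsmul x r := by
    induction x using induction_on with
    | h0 => simp only [map_zero, smul_zero]
    | ht s c =>
      rw [rsmul_tmul, lift_tmul, lift_tmul, BimodHom.map_rsmul, extendLeft_rsmul, smul_comm]
    | ha x y hx hy => simp only [map_add, smul_add, hx, hy]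

theorem extLeftCoact_tmul (s : S) (c : C) : Φ.extLeftCoact (tmul R (RightRes.of φ s) c) =
    s • Φ.extendLeft (Coring.comul (R := R) c) := rfl

/-- The right `C`-coaction `S ⊗_R Δ` of `S ⊗_R C`. -/
def extRightCoact : BimodHom S R Φ.Ext (Φ.Ext ⊛[R] C) where
  toFun := (assoc R R (RightRes φ) C C).symm.toAddMonoidHom.comp
    (map LinearMap.id (Coring.comul (R := R) (C := C)).left)
  map_lsmul a x := by
    change (assoc R R (RightRes φ) C C).symm (map _ _ (a • x)) = _
    rw [BalTensor.map_lsmul _ _ _ (fun _ => rfl), assoc_symm_lsmul]; rfl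
  map_rsmul x r := by
    change (assoc R R (RightRes φ) C C).symm (map _ _ (x <• r)) = _
    rw [BalTensor.map_rsmul _ _ _ (fun c => Coring.comul.map_rsmul c r), assoc_symm_rsmul]; rfl

theorem extRightCoact_tmul (s : RightRes φ) (c : C) : Φ.extRightCoact (tmul R s c) =
    (assoc R R (RightRes φ) C C).symm (tmul R s (Coring.comul (R := R) c)) := rfl

/-- The two coactions of `S ⊗_R C` are compatible. -/
theorem ext_compat (x : Φ.Ext) :
    map Φ.extLeftCoact.right LinearMap.id (Φ.extRightCoact x) =
      (assoc S R D Φ.Ext C).symm (map LinearMap.id Φ.extRightCoact.left (Φ.extLeftCoact x)) := by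
  let V : C ⊛[R] C →+ Φ.Ext ⊛[R] C := map (M' := Φ.Ext) (R := R)
    { Φ.oneTmul with map_smul' := fun _ _ => rfl } LinearMap.id
  let U : C ⊛[R] (C ⊛[R] C) →+ (D ⊛[S] Φ.Ext) ⊛[R] C :=
    (assoc S R D Φ.Ext C).symm.toAddMonoidHom.comp
      (mapSemi φ Φ.toFun V Φ.map_rsmul
        (fun r y => mapSemi_lsmul _ _ _ _ _ r (φ r) (Φ.oneTmul_lsmul r) y))
  have keyA : ∀ (s : S) (w : C ⊛[R] C), map Φ.extLeftCoact.right LinearMap.id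
      ((assoc R R (RightRes φ) C C).symm (tmul R (RightRes.of φ s) w)) =
      s • U (assoc R R C C C (map (Coring.comul (R := R)).right LinearMap.id w)) := by
    intro s w
    induction w using induction_on with
    | h0 => simp only [map_zero, smul_zero, tmul_zero]
    | ht a b =>
      rw [assoc_symm_tmul, map_tmul, map_tmul, BimodHom.right_apply, BimodHom.right_apply,
        extLeftCoact_tmul, ← lsmul_tmul]
      congr 1
      generalize Coring.comul (R := R) a = z
      induction z using induction_on with
      | h0 => simp only [map_zero, zero_tmul]
      | ht m b => rfl
      | ha x y hx hy => simp only [map_add, add_tmul, hx, hy]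
    | ha x y hx hy => simp only [map_add, tmul_add, smul_add, hx, hy]
  have keyB : ∀ y : C ⊛[R] C, (assoc S R D Φ.Ext C).symm
      (map LinearMap.id Φ.extRightCoact.left (Φ.extendLeft y)) =
      U (map LinearMap.id (Coring.comul (R := R)).left y) := by
    intro y
    induction y using induction_on with
    | h0 => simp only [map_zero]
    | ht a b =>
      change (assoc S R D Φ.Ext C).symm (tmul S (Φ.toFun a)
        ((assoc R R (RightRes φ) C C).symm (tmul R (RightRes.of φ 1) (Coring.comul (R := R) b))))
        = (assoc S R D Φ.Ext C).symm (tmul S (Φ.toFun a) (V (Coring.comul (R := R) b)))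
      congr 2
    | ha x y hx hy => simp only [map_add, hx, hy]
  induction x using induction_on with
  | h0 => simp only [map_zero]
  | ht s c =>
    obtain ⟨s, rfl⟩ := (RightRes.of φ).surjective s
    rw [extRightCoact_tmul, keyA, Coring.coassoc, ← keyB, extLeftCoact_tmul,
      BalTensor.map_lsmul _ _ _ (fun _ => rfl), assoc_symm_lsmul]
  | ha x y hx hy => simp only [map_add, hx, hy]

end Bicomodule

end CoringHom

/-! ### Equalizers and their preservation -/

section Preserve

variable {R : Type*} [Ring R]

/-- The left `R`-module `M` preserves the equalizer `i : E → X` of the pair `f, g : X → Y` of maps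
of right `R`-modules: `i ⊗_R M` is an equalizer of `f ⊗_R M` and `g ⊗_R M`. -/
def LeftModulePreservesEqualizer (M : Type*) [AddCommGroup M] [Module R M] {X Y : Type*}
    [AddCommGroup X] [AddCommGroup Y] [Module Rᵐᵒᵖ X] [Module Rᵐᵒᵖ Y] (f g : X →ₗ[Rᵐᵒᵖ] Y) : Prop :=
  Function.Injective (map (LinearMap.eqLocus f g).subtype (LinearMap.id : M →ₗ[R] M)) ∧
  ∀ x : X ⊛[R] M,
    x ∈ Set.range (map (LinearMap.eqLocus f g).subtype (LinearMap.id : M →ₗ[R] M)) ↔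
      map f LinearMap.id x = map g LinearMap.id x

/-- The right `R`-module `M` preserves the equalizer `i : E → X` of the pair `f, g : X → Y` of maps
of left `R`-modules: `M ⊗_R i` is an equalizer of `M ⊗_R f` and `M ⊗_R g`. -/
def RightModulePreservesEqualizer (M : Type*) [AddCommGroup M] [Module Rᵐᵒᵖ M] {X Y : Type*}
    [AddCommGroup X] [AddCommGroup Y] [Module R X] [Module R Y] (f g : X →ₗ[R] Y) : Prop :=
  Function.Injective (map (LinearMap.id : M →ₗ[Rᵐᵒᵖ] M) (LinearMap.eqLocus f g).subtype) ∧
  ∀ x : M ⊛[R] X,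
    x ∈ Set.range (map (LinearMap.id : M →ₗ[Rᵐᵒᵖ] M) (LinearMap.eqLocus f g).subtype) ↔
      map LinearMap.id f x = map LinearMap.id g x

/-- Preservation of an equalizer passes to retracts. -/
theorem LeftModulePreservesEqualizer.retract {M M' : Type*} [AddCommGroup M] [Module R M]
    [AddCommGroup M'] [Module R M'] {X Y : Type*} [AddCommGroup X] [AddCommGroup Y]
    [Module Rᵐᵒᵖ X] [Module Rᵐᵒᵖ Y] {f g : X →ₗ[Rᵐᵒᵖ] Y}
    (h : LeftModulePreservesEqualizer M f g) (j : M' →ₗ[R] M) (p : M →ₗ[R] M')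
    (hp : ∀ m, p (j m) = m) : LeftModulePreservesEqualizer M' f g := by
  have ret : ∀ {A : Type _} [AddCommGroup A] [Module Rᵐᵒᵖ A] (x : A ⊛[R] M'),
      map (LinearMap.id : A →ₗ[Rᵐᵒᵖ] A) p (map LinearMap.id j x) = x := by
    intro A _ _ x
    exact addHom_congr (f := (map LinearMap.id p).comp (map LinearMap.id j))
      (g := AddMonoidHom.id _)
      (fun a b => congrArg (tmul R a) (hp b)) x
  refine ⟨fun x y hxy => ?_, fun x => ⟨?_, fun hx => ?_⟩⟩
  · have h1 := congrArg (map LinearMap.id j) hxy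
    rw [← map_comm, ← map_comm] at h1
    have h2 := congrArg (map LinearMap.id p) (h.1 h1)
    rwa [ret, ret] at h2
  · rintro ⟨z, rfl⟩
    exact addHom_congr (f := (map f LinearMap.id).comp (map _ LinearMap.id))
      (g := (map g LinearMap.id).comp (map _ LinearMap.id))
      (fun a b => congrArg (fun t => tmul R t b) a.2) z
  · obtain ⟨z, hz⟩ := (h.2 (map LinearMap.id j x)).2 (by rw [map_comm, map_comm, hx])
    exact ⟨map LinearMap.id p z, by rw [map_comm, hz, ret]⟩

end Preserve

/-! ### Cotensor products with `S ⊗_R C` -/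

namespace CoringHom

variable {R S : Type*} [Ring R] [Ring S] {φ : R →+* S} {C D : Type*}
  [AddCommGroup C] [Module R C] [Module Rᵐᵒᵖ C] [SMulCommClass R Rᵐᵒᵖ C] [Coring R C]
  [AddCommGroup D] [Module S D] [Module Sᵐᵒᵖ D] [SMulCommClass S Sᵐᵒᵖ D] [Coring S D]
  (Φ : CoringHom φ C D)

section Cotensor

variable {N : Type*} [AddCommGroup N] [Module Sᵐᵒᵖ N] (ρ : N →ₗ[Sᵐᵒᵖ] N ⊛[S] D)

/-- `ρ_N ⊗_S (S ⊗_R C)`, as a map of right `R`-modules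
`N ⊗_S (S ⊗_R C) → N ⊗_S (D ⊗_S (S ⊗_R C))`. -/
def cotensorFst : N ⊛[S] Φ.Ext →ₗ[Rᵐᵒᵖ] N ⊛[S] (D ⊛[S] Φ.Ext) :=
  { (assoc S S N D Φ.Ext).toAddMonoidHom.comp (map ρ LinearMap.id) with
    map_smul' := fun r x => by
      obtain ⟨r, rfl⟩ := MulOpposite.op_surjective r
      change assoc S S N D Φ.Ext (map ρ LinearMap.id (x <• r)) = _
      rw [BalTensor.map_rsmul _ _ _ (fun _ => rfl), assoc_rsmul]; rfl }

/-- `N ⊗_S λ`, for the left `D`-coaction `λ` of `S ⊗_R C`, as a map of right `R`-modules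
`N ⊗_S (S ⊗_R C) → N ⊗_S (D ⊗_S (S ⊗_R C))`. -/
def cotensorSnd (N : Type*) [AddCommGroup N] [Module Sᵐᵒᵖ N] :
    N ⊛[S] Φ.Ext →ₗ[Rᵐᵒᵖ] N ⊛[S] (D ⊛[S] Φ.Ext) :=
  { map (LinearMap.id : N →ₗ[Sᵐᵒᵖ] N) Φ.extLeftCoact.left with
    map_smul' := fun r x => by
      obtain ⟨r, rfl⟩ := MulOpposite.op_surjective r
      exact BalTensor.map_rsmul _ _ _ (fun c => Φ.extLeftCoact.map_rsmul c r) x }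

theorem cotensorFst_apply (x : N ⊛[S] Φ.Ext) :
    Φ.cotensorFst ρ x = assoc S S N D Φ.Ext (map ρ LinearMap.id x) := rfl

theorem cotensorSnd_apply (x : N ⊛[S] Φ.Ext) :
    Φ.cotensorSnd N x = map LinearMap.id Φ.extLeftCoact.left x := rfl

/-- The cotensor product `N □_D (S ⊗_R C)`, a right `R`-submodule of `N ⊗_S (S ⊗_R C)`. -/
abbrev cotensor : Submodule Rᵐᵒᵖ (N ⊛[S] Φ.Ext) :=
  LinearMap.eqLocus (Φ.cotensorFst ρ) (Φ.cotensorSnd N)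

/-- The right `C`-coaction of `N ⊗_S (S ⊗_R C)` coming from the one of `S ⊗_R C`. -/
def tensorRightCoact (N : Type*) [AddCommGroup N] [Module Sᵐᵒᵖ N] :
    N ⊛[S] Φ.Ext →ₗ[Rᵐᵒᵖ] (N ⊛[S] Φ.Ext) ⊛[R] C :=
  { (assoc S R N Φ.Ext C).symm.toAddMonoidHom.comp
      (map (LinearMap.id : N →ₗ[Sᵐᵒᵖ] N) Φ.extRightCoact.left) with
    map_smul' := fun r x => by
      obtain ⟨r, rfl⟩ := MulOpposite.op_surjective r
      change (assoc S R N Φ.Ext C).symm (map _ _ (x <• r)) = _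
      rw [BalTensor.map_rsmul _ _ _ (fun c => Φ.extRightCoact.map_rsmul c r),
        assoc_symm_rsmul]; rfl }

theorem tensorRightCoact_tmul (n : N) (l : Φ.Ext) : Φ.tensorRightCoact N (tmul S n l) =
    (assoc S R N Φ.Ext C).symm (tmul S n (Φ.extRightCoact l)) := rfl

theorem tensorRightCoact_lsmul {A : Type*} [Ring A] [Module A N] [SMulCommClass A Sᵐᵒᵖ N] (a : A)
    (x : N ⊛[S] Φ.Ext) : Φ.tensorRightCoact N (a • x) = a • Φ.tensorRightCoact N x := by
  change (assoc S R N Φ.Ext C).symm (map _ _ (a • x)) = _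
  rw [BalTensor.map_lsmul _ _ _ (fun _ => rfl), assoc_symm_lsmul]; rfl

/-- The right `C`-coaction of `N ⊗_S (D ⊗_S (S ⊗_R C))` coming from the one of `S ⊗_R C`. -/
def tensorRightCoact₂ (N : Type*) [AddCommGroup N] [Module Sᵐᵒᵖ N] :
    N ⊛[S] (D ⊛[S] Φ.Ext) →+ (N ⊛[S] (D ⊛[S] Φ.Ext)) ⊛[R] C :=
  (assoc S R N (D ⊛[S] Φ.Ext) C).symm.toAddMonoidHom.comp
    (map (LinearMap.id : N →ₗ[Sᵐᵒᵖ] N)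
      { Φ.tensorRightCoact D with map_smul' := fun a x => Φ.tensorRightCoact_lsmul a x })

theorem tensorRightCoact_fst (x : N ⊛[S] Φ.Ext) :
    map (Φ.cotensorFst ρ) LinearMap.id (Φ.tensorRightCoact N x) =
      Φ.tensorRightCoact₂ N (Φ.cotensorFst ρ x) := by
  let Ψ : N ⊛[S] (D ⊛[S] (Φ.Ext ⊛[R] C)) →+ (N ⊛[S] (D ⊛[S] Φ.Ext)) ⊛[R] C :=
    (assoc S R N (D ⊛[S] Φ.Ext) C).symm.toAddMonoidHom.comp
    (map (LinearMap.id : N →ₗ[Sᵐᵒᵖ] N)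
      { (assoc S R D Φ.Ext C).symm.toAddMonoidHom with
        map_smul' := fun a x => assoc_symm_lsmul a x })
  have keyA : ∀ (n : N) (w : Φ.Ext ⊛[R] C),
      map (Φ.cotensorFst ρ) LinearMap.id ((assoc S R N Φ.Ext C).symm (tmul S n w)) =
        Ψ (assoc S S N D (Φ.Ext ⊛[R] C) (tmul S (ρ n) w)) := by
    intro n w
    induction w using induction_on with
    | h0 => simp only [map_zero, tmul_zero]
    | ht l c =>
      rw [assoc_symm_tmul, map_tmul, cotensorFst_apply, map_tmul]
      generalize ρ n = z
      induction z using induction_on with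
      | h0 => simp only [map_zero, zero_tmul]
      | ht m d => rfl
      | ha x y hx hy => simp only [map_add, add_tmul, hx, hy]
    | ha x y hx hy => simp only [map_add, tmul_add, hx, hy]
  have keyB : ∀ (z : N ⊛[S] D) (l : Φ.Ext),
      Φ.tensorRightCoact₂ N (assoc S S N D Φ.Ext (tmul S z l)) =
        Ψ (assoc S S N D (Φ.Ext ⊛[R] C) (tmul S z (Φ.extRightCoact l))) := by
    intro z l
    induction z using induction_on with
    | h0 => simp only [map_zero, zero_tmul]
    | ht m d => rfl
    | ha x y hx hy => simp only [map_add, add_tmul, hx, hy]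
  induction x using induction_on with
  | h0 => simp only [map_zero]
  | ht n l => rw [tensorRightCoact_tmul, keyA, cotensorFst_apply, map_tmul, LinearMap.id_apply, keyB]
  | ha x y hx hy => simp only [map_add, hx, hy]

theorem tensorRightCoact_snd (x : N ⊛[S] Φ.Ext) :
    map (Φ.cotensorSnd N) LinearMap.id (Φ.tensorRightCoact N x) =
      Φ.tensorRightCoact₂ N (Φ.cotensorSnd N x) := by
  have keyA : ∀ (n : N) (w : Φ.Ext ⊛[R] C),
      map (Φ.cotensorSnd N) LinearMap.id ((assoc S R N Φ.Ext C).symm (tmul S n w)) =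
        (assoc S R N (D ⊛[S] Φ.Ext) C).symm
          (tmul S n (map Φ.extLeftCoact.right LinearMap.id w)) := by
    intro n w
    induction w using induction_on with
    | h0 => simp only [map_zero, tmul_zero]
    | ht l c => rfl
    | ha x y hx hy => simp only [map_add, tmul_add, hx, hy]
  induction x using induction_on with
  | h0 => simp only [map_zero]
  | ht n l => rw [tensorRightCoact_tmul, keyA, ext_compat]; rfl
  | ha x y hx hy => simp only [map_add, hx, hy]

theorem exists_cotensorCoact (h : LeftModulePreservesEqualizer C (Φ.cotensorFst ρ) (Φ.cotensorSnd N))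
    (x : Φ.cotensor ρ) : ∃ z : Φ.cotensor ρ ⊛[R] C,
      map (Φ.cotensor ρ).subtype LinearMap.id z = Φ.tensorRightCoact N x :=
  (h.2 _).2 (by
    rw [tensorRightCoact_fst, tensorRightCoact_snd]
    exact congrArg _ x.2)

/-- The right `C`-coaction of `N □_D (S ⊗_R C)`: the unique map whose composition with
`i ⊗_R C : (N □_D (S ⊗_R C)) ⊗_R C → (N ⊗_S (S ⊗_R C)) ⊗_R C` is the restriction of the coaction of
`N ⊗_S (S ⊗_R C)`. It exists if the left `R`-module `C` preserves the defining equalizer. -/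
def cotensorRightCoact
    (h : LeftModulePreservesEqualizer C (Φ.cotensorFst ρ) (Φ.cotensorSnd N)) :
    Φ.cotensor ρ →ₗ[Rᵐᵒᵖ] Φ.cotensor ρ ⊛[R] C where
  toFun x := (Φ.exists_cotensorCoact ρ h x).choose
  map_add' x y := h.1 (by
    rw [map_add, (Φ.exists_cotensorCoact ρ h (x + y)).choose_spec,
      (Φ.exists_cotensorCoact ρ h x).choose_spec, (Φ.exists_cotensorCoact ρ h y).choose_spec]
    exact map_add (Φ.tensorRightCoact N) (x : N ⊛[S] Φ.Ext) y)
  map_smul' r x := h.1 (by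
    obtain ⟨r, rfl⟩ := MulOpposite.op_surjective r
    rw [RingHom.id_apply, BalTensor.map_rsmul _ _ _ (fun _ => rfl),
      (Φ.exists_cotensorCoact ρ h (x <• r)).choose_spec,
      (Φ.exists_cotensorCoact ρ h x).choose_spec]
    exact (Φ.tensorRightCoact N).map_smul (MulOpposite.op r) (x : N ⊛[S] Φ.Ext))

theorem cotensorRightCoact_spec
    (h : LeftModulePreservesEqualizer C (Φ.cotensorFst ρ) (Φ.cotensorSnd N)) (x : Φ.cotensor ρ) :
    map (Φ.cotensor ρ).subtype LinearMap.id (Φ.cotensorRightCoact ρ h x) =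
      Φ.tensorRightCoact N x := (Φ.exists_cotensorCoact ρ h x).choose_spec

end Cotensor

/-- If `C ⊗_R C` preserves an equalizer, so does its retract `C`. -/
theorem _root_.LeftModulePreservesEqualizer.of_tensor {X Y : Type*} [AddCommGroup X] [AddCommGroup Y]
    [Module Rᵐᵒᵖ X] [Module Rᵐᵒᵖ Y] {f g : X →ₗ[Rᵐᵒᵖ] Y}
    (h : LeftModulePreservesEqualizer (C ⊛[R] C) f g) : LeftModulePreservesEqualizer C f g :=
  h.retract (Coring.comul (R := R)).left
    { (lid R C).comp (map (Coring.counit (R := R) (C := C)).right LinearMap.id) with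
      map_smul' := fun r x => by
        change lid R C (map _ _ (r • x)) = r • lid R C (map _ _ x)
        rw [BalTensor.map_lsmul _ _ _ (fun c => Coring.counit.map_lsmul r c)]
        generalize map (Coring.counit (R := R) (C := C)).right LinearMap.id x = y
        induction y using induction_on with
        | h0 => simp only [map_zero, smul_zero]
        | ht a c => exact mul_smul _ _ _
        | ha x y hx hy => simp only [map_add, smul_add, hx, hy] }
    Coring.counit_comul

/-! ### The bicomodule `GFC = (C ⊗_R S) □_D (S ⊗_R C)` and the unit -/

section GF

/-- The right `D`-coaction of `C ⊗_R S`. -/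
abbrev selfCoact : C ⊛[R] LeftRes φ →ₗ[Sᵐᵒᵖ] (C ⊛[R] LeftRes φ) ⊛[S] D :=
  Φ.indCoact (Coring.comul (R := R)).right

/-- `ρ ⊗_S (S ⊗_R C)`, for the right `D`-coaction `ρ` of `C ⊗_R S`, as a map of left `R`-modules. -/
def selfFst : (C ⊛[R] LeftRes φ) ⊛[S] Φ.Ext →ₗ[R] (C ⊛[R] LeftRes φ) ⊛[S] (D ⊛[S] Φ.Ext) :=
  { Φ.cotensorFst Φ.selfCoact with
    map_smul' := fun r x => by
      change assoc S S _ D Φ.Ext (map _ _ (r • x)) = _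
      rw [BalTensor.map_lsmul _ _ _ (fun y => Φ.indCoact_lsmul _
        (fun a c => Coring.comul.map_lsmul a c) r y), assoc_lsmul]
      rfl }

/-- `(C ⊗_R S) ⊗_S λ`, for the left `D`-coaction `λ` of `S ⊗_R C`, as a map of left `R`-modules. -/
def selfSnd : (C ⊛[R] LeftRes φ) ⊛[S] Φ.Ext →ₗ[R] (C ⊛[R] LeftRes φ) ⊛[S] (D ⊛[S] Φ.Ext) :=
  { Φ.cotensorSnd (C ⊛[R] LeftRes φ) with
    map_smul' := fun _ x => BalTensor.map_lsmul _ _ _ (fun _ => rfl) x }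

/-- The `R`-bimodule `GFC = (C ⊗_R S) □_D (S ⊗_R C)`, a subbimodule of
`(C ⊗_R S) ⊗_S (S ⊗_R C)`. -/
def GFC : Type _ := Φ.cotensor Φ.selfCoact

instance : AddCommGroup Φ.GFC := inferInstanceAs (AddCommGroup (Φ.cotensor Φ.selfCoact))

instance : Module Rᵐᵒᵖ Φ.GFC := inferInstanceAs (Module Rᵐᵒᵖ (Φ.cotensor Φ.selfCoact))

instance : Module R Φ.GFC := inferInstanceAs (Module R (LinearMap.eqLocus Φ.selfFst Φ.selfSnd))

/-- The inclusion of `GFC` in `(C ⊗_R S) ⊗_S (S ⊗_R C)`. -/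
def GFC.incl : BimodHom R R Φ.GFC ((C ⊛[R] LeftRes φ) ⊛[S] Φ.Ext) where
  toFun := (Φ.cotensor Φ.selfCoact).subtype.toAddMonoidHom
  map_lsmul _ _ := rfl
  map_rsmul _ _ := rfl

theorem GFC.incl_injective : Function.Injective (GFC.incl Φ) := Subtype.val_injective

instance : SMulCommClass R Rᵐᵒᵖ Φ.GFC :=
  ⟨fun r s x => GFC.incl_injective Φ (smul_comm r s (GFC.incl Φ x))⟩

/-- The left `C`-coaction of `C ⊗_R S` coming from the comultiplication of `C`. -/
def selfLeftCoact : C ⊛[R] LeftRes φ →ₗ[Sᵐᵒᵖ] C ⊛[R] (C ⊛[R] LeftRes φ) :=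
  { (assoc R R C C (LeftRes φ)).toAddMonoidHom.comp
      (map (Coring.comul (R := R) (C := C)).right LinearMap.id) with
    map_smul' := fun s x => by
      obtain ⟨s, rfl⟩ := MulOpposite.op_surjective s
      change assoc R R C C (LeftRes φ) (map _ _ (x <• s)) = _
      rw [BalTensor.map_rsmul _ _ _ (fun _ => rfl), assoc_rsmul]; rfl }

theorem selfLeftCoact_tmul (c : C) (s : LeftRes φ) : selfLeftCoact (tmul R c s) =
    assoc R R C C (LeftRes φ) (tmul R (Coring.comul (R := R) c) s) := rfl

/-- The left `C`-coaction of `(C ⊗_R S) ⊗_S (S ⊗_R C)` coming from the one of `C ⊗_R S`. -/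
def tensorLeftCoact :
    (C ⊛[R] LeftRes φ) ⊛[S] Φ.Ext →ₗ[R] C ⊛[R] ((C ⊛[R] LeftRes φ) ⊛[S] Φ.Ext) :=
  { (assoc R S C (C ⊛[R] LeftRes φ) Φ.Ext).toAddMonoidHom.comp
      (map selfLeftCoact LinearMap.id) with
    map_smul' := fun r x => by
      change assoc R S C (C ⊛[R] LeftRes φ) Φ.Ext (map _ _ (r • x)) = _
      rw [BalTensor.map_lsmul, assoc_lsmul]
      · rfl
      · intro m
        change assoc R R C C (LeftRes φ) (map _ _ (r • m)) = _
        rw [BalTensor.map_lsmul _ _ _ (fun c => Coring.comul.map_lsmul r c), assoc_lsmul]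
        rfl }

/-- The map `C ⊗_R C → (C ⊗_R S) ⊗_S (D ⊗_S (S ⊗_R C))`, `c ⊗ c' ↦ (c ⊗ 1) ⊗ (Φ(c') s ⊗ l)`. -/
def extendTensor (s : S) (l : Φ.Ext) :
    C ⊛[R] C →ₗ[R] (C ⊛[R] LeftRes φ) ⊛[S] (D ⊛[S] Φ.Ext) where
  toFun y := assoc S S _ D Φ.Ext (tmul S (Φ.extend C y <• s) l)
  map_add' x y := by rw [map_add, smul_add, add_tmul, map_add]
  map_smul' r x := by
    have h : Φ.extend C (r • x) = r • Φ.extend C x :=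
      mapSemi_lsmul _ _ _ _ _ r r (fun _ => rfl) x
    rw [h, ← smul_comm r, ← lsmul_tmul, assoc_lsmul, RingHom.id_apply]

theorem tensorLeftCoact_tmul (c : C) (s : LeftRes φ) (l : Φ.Ext) :
    Φ.tensorLeftCoact (tmul S (tmul R c s) l) =
      assoc R S C (C ⊛[R] LeftRes φ) Φ.Ext (tmul S
        (assoc R R C C (LeftRes φ) (tmul R (Coring.comul (R := R) c) s)) l) := rfl

theorem tensorLeftCoact_fst (x : (C ⊛[R] LeftRes φ) ⊛[S] Φ.Ext) :
    map LinearMap.id Φ.selfFst (Φ.tensorLeftCoact x) =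
      assoc R S C (C ⊛[R] LeftRes φ) (D ⊛[S] Φ.Ext) (map selfLeftCoact LinearMap.id
        (Φ.selfFst x)) := by
  have key : ∀ (s : S) (l : Φ.Ext) (y : C ⊛[R] C),
      assoc R S C (C ⊛[R] LeftRes φ) (D ⊛[S] Φ.Ext) (map selfLeftCoact LinearMap.id
        (assoc S S _ D Φ.Ext (tmul S (Φ.extend C y <• s) l))) =
      map LinearMap.id (Φ.extendTensor s l)
        (assoc R R C C C (map (Coring.comul (R := R)).right LinearMap.id y)) := by
    intro s l y
    induction y using induction_on with
    | h0 => simp only [map_zero, smul_zero, zero_tmul]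
    | ht a b =>
      rw [extend_tmul, rsmul_tmul, assoc_tmul, map_tmul, map_tmul, selfLeftCoact_tmul]
      change assoc R S C (C ⊛[R] LeftRes φ) (D ⊛[S] Φ.Ext) (tmul S
        (assoc R R C C (LeftRes φ) (tmul R (Coring.comul (R := R) a) (LeftRes.of φ 1))) _) =
        map LinearMap.id (Φ.extendTensor s l)
          (assoc R R C C C (tmul R (Coring.comul (R := R) a) b))
      generalize Coring.comul (R := R) a = z
      induction z using induction_on with
      | h0 => simp only [map_zero, zero_tmul]
      | ht m b => rfl
      | ha x y hx hy => simp only [map_add, add_tmul, hx, hy]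
    | ha x y hx hy => simp only [map_add, smul_add, add_tmul, hx, hy]
  refine DFunLike.congr_fun (addHom_ext₃
    (f := (map LinearMap.id Φ.selfFst).comp Φ.tensorLeftCoact.toAddMonoidHom)
    (g := ((assoc R S C (C ⊛[R] LeftRes φ) (D ⊛[S] Φ.Ext)).toAddMonoidHom.comp
      (map selfLeftCoact LinearMap.id)).comp Φ.selfFst.toAddMonoidHom) fun c s l => ?_) x
  obtain ⟨s, rfl⟩ := (LeftRes.of φ).surjective s
  change map LinearMap.id Φ.selfFst (Φ.tensorLeftCoact (tmul S (tmul R c (LeftRes.of φ s)) l)) =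
    assoc R S C (C ⊛[R] LeftRes φ) (D ⊛[S] Φ.Ext) (map selfLeftCoact LinearMap.id
      (assoc S S _ D Φ.Ext
        (tmul S (Φ.extend C (Coring.comul (R := R) c) <• s) l)))
  rw [key]
  rw [Coring.coassoc, tensorLeftCoact_tmul]
  generalize Coring.comul (R := R) c = z
  induction z using induction_on with
  | h0 => simp only [map_zero, zero_tmul]
  | ht m b => rfl
  | ha x y hx hy => simp only [map_add, add_tmul, hx, hy]

theorem tensorLeftCoact_snd (x : (C ⊛[R] LeftRes φ) ⊛[S] Φ.Ext) :
    map LinearMap.id Φ.selfSnd (Φ.tensorLeftCoact x) =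
      assoc R S C (C ⊛[R] LeftRes φ) (D ⊛[S] Φ.Ext) (map selfLeftCoact LinearMap.id
        (Φ.selfSnd x)) := by
  refine DFunLike.congr_fun (addHom_ext₃
    (f := (map LinearMap.id Φ.selfSnd).comp Φ.tensorLeftCoact.toAddMonoidHom)
    (g := ((assoc R S C (C ⊛[R] LeftRes φ) (D ⊛[S] Φ.Ext)).toAddMonoidHom.comp
      (map selfLeftCoact LinearMap.id)).comp Φ.selfSnd.toAddMonoidHom) fun c s l => ?_) x
  change map LinearMap.id Φ.selfSnd (Φ.tensorLeftCoact (tmul S (tmul R c s) l)) =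
    assoc R S C (C ⊛[R] LeftRes φ) (D ⊛[S] Φ.Ext) (tmul S
      (assoc R R C C (LeftRes φ) (tmul R (Coring.comul (R := R) c) s)) (Φ.extLeftCoact l))
  rw [tensorLeftCoact_tmul]
  generalize Coring.comul (R := R) c = z
  induction z using induction_on with
  | h0 => simp only [map_zero, zero_tmul]
  | ht m b => rfl
  | ha x y hx hy => simp only [map_add, add_tmul, hx, hy]

/-- The `R`-bimodule `GFC`, as the equalizer of `selfFst` and `selfSnd` in left `R`-modules. -/
def GFC.ofEqLocus : LinearMap.eqLocus Φ.selfFst Φ.selfSnd →ₗ[R] Φ.GFC where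
  toFun x := ⟨x.1, x.2⟩
  map_add' _ _ := rfl
  map_smul' _ _ := rfl

theorem GFC.exists_leftCoact (h : RightModulePreservesEqualizer C Φ.selfFst Φ.selfSnd)
    (x : Φ.GFC) : ∃! z : C ⊛[R] Φ.GFC,
      map LinearMap.id (GFC.incl Φ).left z = Φ.tensorLeftCoact (GFC.incl Φ x) := by
  have hx : Φ.selfFst (GFC.incl Φ x) = Φ.selfSnd (GFC.incl Φ x) := x.2
  let e' : Φ.GFC →ₗ[R] LinearMap.eqLocus Φ.selfFst Φ.selfSnd :=
    { toFun := fun x => ⟨x.1, x.2⟩, map_add' := fun _ _ => rfl, map_smul' := fun _ _ => rfl }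
  obtain ⟨z, hz⟩ := (h.2 (Φ.tensorLeftCoact (GFC.incl Φ x))).2 (by
    rw [tensorLeftCoact_fst, tensorLeftCoact_snd, hx])
  have h₁ : ∀ z, map LinearMap.id (GFC.incl Φ).left (map LinearMap.id (GFC.ofEqLocus Φ) z) =
      map (LinearMap.id : C →ₗ[Rᵐᵒᵖ] C) (LinearMap.eqLocus Φ.selfFst Φ.selfSnd).subtype z :=
    fun z => addHom_congr (f := (map LinearMap.id (GFC.incl Φ).left).comp
      (map LinearMap.id (GFC.ofEqLocus Φ)))
      (g := map LinearMap.id (LinearMap.eqLocus Φ.selfFst Φ.selfSnd).subtype) (fun _ _ => rfl) z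
  have h₂ : ∀ z : C ⊛[R] Φ.GFC,
      map LinearMap.id (GFC.ofEqLocus Φ) (map LinearMap.id e' z) = z :=
    fun z => addHom_congr (f := (map LinearMap.id (GFC.ofEqLocus Φ)).comp
      (map LinearMap.id e')) (g := AddMonoidHom.id _) (fun _ _ => rfl) z
  refine ⟨map LinearMap.id (GFC.ofEqLocus Φ) z, (h₁ z).trans hz, fun y hy => ?_⟩
  rw [← h₂ y] at hy ⊢
  rw [h₁, ← hz] at hy
  rw [h.1 hy]

/-- The left `C`-coaction of `GFC`: the unique map whose composition with
`C ⊗_R i : C ⊗_R GFC → C ⊗_R ((C ⊗_R S) ⊗_S (S ⊗_R C))` is the restriction of the left coaction of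
`(C ⊗_R S) ⊗_S (S ⊗_R C)`. It exists if the right `R`-module `C` preserves the defining
equalizer. -/
def GFC.leftCoact (h : RightModulePreservesEqualizer C Φ.selfFst Φ.selfSnd) :
    Φ.GFC →ₗ[R] C ⊛[R] Φ.GFC where
  toFun x := (GFC.exists_leftCoact Φ h x).choose
  map_add' x y := (GFC.exists_leftCoact Φ h (x + y)).unique
    (GFC.exists_leftCoact Φ h (x + y)).choose_spec.1 (by
      rw [map_add, (GFC.exists_leftCoact Φ h x).choose_spec.1,
        (GFC.exists_leftCoact Φ h y).choose_spec.1, map_add, map_add])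
  map_smul' r x := (GFC.exists_leftCoact Φ h (r • x)).unique
    (GFC.exists_leftCoact Φ h (r • x)).choose_spec.1 (by
      rw [RingHom.id_apply, BalTensor.map_lsmul _ _ _ (fun _ => rfl),
        (GFC.exists_leftCoact Φ h x).choose_spec.1, (GFC.incl Φ).map_lsmul, map_smul])

theorem GFC.leftCoact_spec (h : RightModulePreservesEqualizer C Φ.selfFst Φ.selfSnd) (x : Φ.GFC) :
    map LinearMap.id (GFC.incl Φ).left (GFC.leftCoact Φ h x) =
      Φ.tensorLeftCoact (GFC.incl Φ x) := (GFC.exists_leftCoact Φ h x).choose_spec.1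

/-- The right `C`-coaction of `GFC`. -/
def GFC.rightCoact
    (h : LeftModulePreservesEqualizer C (Φ.cotensorFst Φ.selfCoact) (Φ.cotensorSnd _)) :
    Φ.GFC →ₗ[Rᵐᵒᵖ] Φ.GFC ⊛[R] C :=
  Φ.cotensorRightCoact Φ.selfCoact h

/-- The map `C → (C ⊗_R S) ⊗_S (S ⊗_R C)`, `c ↦ (c₁ ⊗ 1) ⊗ (1 ⊗ c₂)`. -/
def unitTensor : C →+ (C ⊛[R] LeftRes φ) ⊛[S] Φ.Ext :=
  (mapSemi φ (tmulOne φ C) Φ.oneTmul tmulOne_rsmul Φ.oneTmul_lsmul).comp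
    (Coring.comul (R := R) (C := C)).toFun

theorem unitTensor_mem (c : C) : Φ.unitTensor c ∈ Φ.cotensor Φ.selfCoact := by
  let T : C ⊛[R] (C ⊛[R] C) →+ (C ⊛[R] LeftRes φ) ⊛[S] (D ⊛[S] Φ.Ext) :=
    mapSemi φ (tmulOne φ C) Φ.extendLeft tmulOne_rsmul Φ.extendLeft_lsmul
  have keyA : ∀ y : C ⊛[R] C, Φ.cotensorFst Φ.selfCoact
      (mapSemi φ (tmulOne φ C) Φ.oneTmul tmulOne_rsmul Φ.oneTmul_lsmul y) =
      T (assoc R R C C C (map (Coring.comul (R := R)).right LinearMap.id y)) := by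
    intro y
    induction y using induction_on with
    | h0 => simp only [map_zero]
    | ht a b =>
      rw [cotensorFst_apply, mapSemi_tmul, map_tmul, map_tmul, tmulOne_apply, indCoact_one]
      generalize (Coring.comul (R := R)).right a = z
      induction z using induction_on with
      | h0 => simp only [map_zero, zero_tmul]
      | ht m b => rfl
      | ha x y hx hy => simp only [map_add, add_tmul, hx, hy]
    | ha x y hx hy => simp only [map_add, hx, hy]
  have keyB : ∀ y : C ⊛[R] C, Φ.cotensorSnd _
      (mapSemi φ (tmulOne φ C) Φ.oneTmul tmulOne_rsmul Φ.oneTmul_lsmul y) =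
      T (map LinearMap.id (Coring.comul (R := R)).left y) := by
    intro y
    induction y using induction_on with
    | h0 => simp only [map_zero]
    | ht a b =>
      rw [cotensorSnd_apply, mapSemi_tmul, map_tmul, map_tmul, oneTmul_apply,
        BimodHom.left_apply, extLeftCoact_tmul, one_smul]
      rfl
    | ha x y hx hy => simp only [map_add, hx, hy]
  change Φ.cotensorFst Φ.selfCoact _ = Φ.cotensorSnd _ _
  exact (keyA _).trans ((congrArg T (Coring.coassoc c)).trans (keyB _).symm)

/-- The component `η_C : C → GFC`, `c ↦ (c₁ ⊗ 1) □ (1 ⊗ c₂)`, of the unit. -/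
def unit : C →+ Φ.GFC :=
  AddMonoidHom.mk' (fun c => (⟨Φ.unitTensor c, Φ.unitTensor_mem c⟩ : Φ.cotensor Φ.selfCoact))
    (fun _ _ => Subtype.ext (map_add _ _ _))

end GF

end CoringHom

/-! ### The induction functor and natural fullness -/

section Functor

open CategoryTheory

variable {R S : Type u} [Ring R] [Ring S] {φ : R →+* S} {C D : Type u}
  [AddCommGroup C] [Module R C] [Module Rᵐᵒᵖ C] [SMulCommClass R Rᵐᵒᵖ C] [Coring R C]
  [AddCommGroup D] [Module S D] [Module Sᵐᵒᵖ D] [SMulCommClass S Sᵐᵒᵖ D] [Coring S D]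

/-- The right `D`-comodule `M ⊗_R S` induced by a right `C`-comodule `M`. -/
def RightComodule.induce (Φ : CoringHom φ C D) (M : RightComodule R C) : RightComodule S D where
  carrier := M ⊛[R] LeftRes φ
  coact := Φ.indCoact M.coact
  coassoc := Φ.indCoact_coassoc M.coact M.coassoc
  counit := Φ.indCoact_counit M.coact M.counit

/-- The induction functor `- ⊗_R S` from right `C`-comodules to right `D`-comodules. -/
def inductionFunctor (Φ : CoringHom φ C D) : RightComodule R C ⥤ RightComodule S D where
  obj M := M.induce Φ
  map {M N} f := RightComodule.Hom.mk (M := M.induce Φ) (N := N.induce Φ)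
    (rTensor (B := S) (LeftRes φ) (RightComodule.Hom.toLinearMap f))
    (Φ.indCoact_natural M.coact N.coact _ (RightComodule.Hom.colinear f))
  map_id _ := RightComodule.Hom.ext (LinearMap.ext fun x =>
    addHom_congr (f := map LinearMap.id LinearMap.id) (g := AddMonoidHom.id _) (fun _ _ => rfl) x)
  map_comp f g := RightComodule.Hom.ext (LinearMap.ext fun x =>
    addHom_congr (f := map (g.toLinearMap.comp f.toLinearMap) LinearMap.id)
      (g := (map g.toLinearMap LinearMap.id).comp (map f.toLinearMap LinearMap.id))
      (fun _ _ => rfl) x)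

/-- A functor `F` is naturally full if the natural transformation
`Hom(-, -) → Hom(F -, F -)`, `f ↦ F f`, has a natural right inverse. -/
def NaturallyFull {A B : Type*} [Category A] [Category B] (F : A ⥤ B) : Prop :=
  ∃ P : ∀ X Y : A, (F.obj X ⟶ F.obj Y) → (X ⟶ Y),
    (∀ {X Y Z T : A} (f : X ⟶ Y) (g : F.obj Y ⟶ F.obj Z) (h : Z ⟶ T),
      P X T (F.map f ≫ g ≫ F.map h) = f ≫ P Y Z g ≫ h) ∧
    ∀ {X Y : A} (g : F.obj X ⟶ F.obj Y), F.map (P X Y g) = g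

end Functor

/-- A homomorphism of `C`-bicomodules `N → C`, where the bimodule `N` has right and left
`C`-coactions `ρ` and `lam`: a bimodule map that is right and left `C`-colinear. -/
structure IsBicolinearToSelf {R C N : Type*} [Ring R] [AddCommGroup C] [Module R C]
    [Module Rᵐᵒᵖ C] [SMulCommClass R Rᵐᵒᵖ C] [Coring R C] [AddCommGroup N] [Module R N]
    [Module Rᵐᵒᵖ N] [SMulCommClass R Rᵐᵒᵖ N] (ρ : N →ₗ[Rᵐᵒᵖ] N ⊛[R] C) (lam : N →ₗ[R] C ⊛[R] N)
    (ν : BimodHom R R N C) : Prop where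
  right_colinear : ∀ x, Coring.comul (R := R) (ν x) = map ν.right LinearMap.id (ρ x)
  left_colinear : ∀ x, Coring.comul (R := R) (ν x) = map LinearMap.id ν.left (lam x)

end

/-!
Write `F = - ⊗_R S`, with right adjoint `G = - □_D (S ⊗_R C)`.  The adjunction sends a colinear map
`u : M ⊗_R S → N` to `m ↦ u (m₀ ⊗ 1) ⊗ (1 ⊗ m₁)`; that `GN` is a comodule uses that `C ⊗_R C`
preserves the equalizer defining `GN`.  By the Yoneda lemma, `F` is naturally full if and only if
there is a natural transformation `ν : GF → id` with `η_M ∘ ν_M = id` for the unit `η : id → GF`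
(`naturallyFull_iff_of_adjunction`).  It remains to compare such `ν` with bicomodule maps
`GFC → C`.

The link is the comparison map `M ⊗_R GFC → GF(M ⊗_R C)`, defined for every right `R`-module `M`,
which is `GF(m ⊗ -)` on `m ⊗ GFC` (`CoringHom.comparison_tmul`).  For `M = C`, its composition with
the left coaction of `GFC` is `GF(Δ)` (`CoringHom.map_coactHom_self`).

Given `ν`, its component at `C` is left `R`-linear by naturality at the left multiplications.
Naturality at the maps `c ↦ m ⊗ c` shows that `ν` at `C ⊗_R C` becomes `C ⊗_R ν_C` along the
comparison map, and then naturality at `Δ : C → C ⊗_R C` says that `ν_C` is left colinear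
(`CoringHom.componentSelf_isBicolinear`).

Conversely, let `ν_C` be a bicomodule map with `η_C ∘ ν_C = id`.  If a right module `M` preserves
the equalizer defining `GFC`, the comparison map is bijective, so that `M ⊗_R ν_C` defines a map
`GF(M ⊗_R C) → M ⊗_R C` (`CoringHom.cofreeSection`).  It is colinear and natural in the module
`M`, its composition with the unit is the identity, and it commutes with `M ⊗_R Δ` since `ν_C` is
left colinear.  For a comodule `M` the coaction `M → M ⊗_R C` is the equalizer of the maps
`ρ_M ⊗_R C` and `M ⊗_R Δ` of cofree comodules (`RightComodule.exists_lift`), so these maps induce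
maps `GFM → M` (`CoringHom.exists_unitSection_of_cofree`).
-/

noncomputable section

open BalTensor CategoryTheory

/-! ### Naturally full functors with a right adjoint -/

/-- A left adjoint is naturally full if and only if its unit is a naturally split epimorphism: if
`P` is a natural right inverse of `f ↦ F f`, the value of `P` at the counit `FGF X → F X` is the
component at `X` of the splitting. -/
theorem naturallyFull_iff_of_adjunction {A B : Type*} [Category A] [Category B] {F : A ⥤ B}
    {G : B ⥤ A} (adj : F ⊣ G) :
    NaturallyFull F ↔ ∃ ν : F ⋙ G ⟶ 𝟭 A, ∀ X, ν.app X ≫ adj.unit.app X = 𝟙 _ := by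
  constructor
  · rintro ⟨P, hnat, hfull⟩
    have hl {X Y Z : A} (f : X ⟶ Y) (g : F.obj Y ⟶ F.obj Z) :
        P X Z (F.map f ≫ g) = f ≫ P Y Z g := by
      simpa using hnat f g (𝟙 Z)
    have hr {X Y Z : A} (g : F.obj X ⟶ F.obj Y) (h : Y ⟶ Z) :
        P X Z (g ≫ F.map h) = P X Y g ≫ h := by
      simpa using hnat (𝟙 X) g h
    refine ⟨{ app := fun X => P _ _ (adj.counit.app (F.obj X)), naturality := fun X Y f => ?_ },
      fun X => ?_⟩
    · have h := adj.counit.naturality (F.map f)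
      simp only [Functor.comp_map, Functor.id_map] at h ⊢
      rw [← hl, ← hr, h]
    · have h := adj.unit.naturality (P _ _ (adj.counit.app (F.obj X)))
      simp only [Functor.comp_map, Functor.id_map] at h
      refine h.trans ?_
      rw [hfull, adj.right_triangle_components]
      rfl
  · rintro ⟨ν, hν⟩
    refine ⟨fun X Y u => adj.unit.app X ≫ G.map u ≫ ν.app Y, fun {X Y Z T} f g h => ?_,
      fun {X Y} g => ?_⟩
    · have h₁ := ν.naturality h
      have h₂ := adj.unit.naturality f
      simp only [Functor.comp_map, Functor.id_map, Category.assoc, G.map_comp] at h₁ h₂ ⊢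
      rw [h₁, reassoc_of% h₂]
    · apply (adj.homEquiv _ _).injective
      rw [adj.homEquiv_unit, adj.homEquiv_unit]
      have h := adj.unit.naturality (adj.unit.app X ≫ G.map g ≫ ν.app Y)
      simp only [Functor.comp_map, Functor.id_map] at h
      refine h.symm.trans ?_
      rw [Category.assoc, Category.assoc]
      exact congrArg (adj.unit.app X ≫ ·)
        ((congrArg (G.map g ≫ ·) (hν Y)).trans (Category.comp_id _))

/-! ### Tensor product identities -/

namespace BalTensor

section

variable {R S : Type*} [Ring R] [Ring S]

theorem map_id_id {M N : Type*} [AddCommGroup M] [AddCommGroup N] [Module Rᵐᵒᵖ M] [Module R N]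
    (x : M ⊛[R] N) : map (LinearMap.id : M →ₗ[Rᵐᵒᵖ] M) (LinearMap.id : N →ₗ[R] N) x = x :=
  addHom_congr (f := map LinearMap.id LinearMap.id) (g := AddMonoidHom.id _) (fun _ _ => rfl) x

theorem map_map {M N M' N' M'' N'' : Type*} [AddCommGroup M] [AddCommGroup N] [AddCommGroup M']
    [AddCommGroup N'] [AddCommGroup M''] [AddCommGroup N''] [Module Rᵐᵒᵖ M] [Module R N]
    [Module Rᵐᵒᵖ M'] [Module R N'] [Module Rᵐᵒᵖ M''] [Module R N'']
    (f : M →ₗ[Rᵐᵒᵖ] M') (g : N →ₗ[R] N') (f' : M' →ₗ[Rᵐᵒᵖ] M'') (g' : N' →ₗ[R] N'')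
    (x : M ⊛[R] N) : map f' g' (map f g x) = map (f'.comp f) (g'.comp g) x :=
  addHom_congr (f := (map f' g').comp (map f g)) (g := map (f'.comp f) (g'.comp g))
    (fun _ _ => rfl) x

/-- Naturality of the associativity isomorphism in its first variable. -/
theorem assoc_map_map {M M' N P : Type*} [AddCommGroup M] [AddCommGroup M'] [AddCommGroup N]
    [AddCommGroup P] [Module Rᵐᵒᵖ M] [Module Rᵐᵒᵖ M'] [Module R N] [Module Sᵐᵒᵖ N]
    [SMulCommClass R Sᵐᵒᵖ N] [Module S P] (f : M →ₗ[Rᵐᵒᵖ] M') (x : (M ⊛[R] N) ⊛[S] P) :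
    assoc R S M' N P (map (rTensor N f) LinearMap.id x) = map f LinearMap.id (assoc R S M N P x) :=
  DFunLike.congr_fun (addHom_ext₃
    (f := (assoc R S M' N P).toAddMonoidHom.comp (map (rTensor N f) LinearMap.id))
    (g := (map f LinearMap.id).comp (assoc R S M N P).toAddMonoidHom) fun _ _ _ => rfl) x

theorem rid_map {M M' : Type*} [AddCommGroup M] [AddCommGroup M'] [Module Rᵐᵒᵖ M]
    [Module Rᵐᵒᵖ M'] (f : M →ₗ[Rᵐᵒᵖ] M') (x : M ⊛[R] R) :
    rid R M' (map f LinearMap.id x) = f (rid R M x) :=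
  addHom_congr (f := (rid R M').comp (map f LinearMap.id)) (g := f.toAddMonoidHom.comp (rid R M))
    (fun m r => (f.map_smul (MulOpposite.op r) m).symm) x

end

end BalTensor

/-! ### Right comodules -/

namespace RightComodule

variable {R : Type u} [Ring R] {C : Type u} [AddCommGroup C] [Module R C]
    [Module Rᵐᵒᵖ C] [SMulCommClass R Rᵐᵒᵖ C] [Coring R C]

theorem hom_ext {M N : RightComodule R C} {f g : M ⟶ N}
    (h : ∀ m, Hom.toLinearMap f m = Hom.toLinearMap g m) : f = g :=
  Hom.ext (LinearMap.ext h)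

theorem hom_congr {M N : RightComodule R C} {f g : M ⟶ N} (h : f = g) (m : M) :
    Hom.toLinearMap f m = Hom.toLinearMap g m := by rw [h]

end RightComodule

/-! ### The right adjoint of the induction functor -/

namespace CoringHom

section Tensor

variable {R S : Type*} [Ring R] [Ring S] {φ : R →+* S} {C D : Type*}
  [AddCommGroup C] [Module R C] [Module Rᵐᵒᵖ C] [SMulCommClass R Rᵐᵒᵖ C] [Coring R C]
  [AddCommGroup D] [Module S D] [Module Sᵐᵒᵖ D] [SMulCommClass S Sᵐᵒᵖ D] [Coring S D]
  (Φ : CoringHom φ C D)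

section

variable {N N' : Type*} [AddCommGroup N] [Module Sᵐᵒᵖ N] [AddCommGroup N'] [Module Sᵐᵒᵖ N']

theorem extRightCoact_coassoc (x : Φ.Ext) :
    assoc R R Φ.Ext C C (map Φ.extRightCoact.right LinearMap.id (Φ.extRightCoact x)) =
      map LinearMap.id (Coring.comul (R := R)).left (Φ.extRightCoact x) := by
  let V (s : RightRes φ) : C ⊛[R] (C ⊛[R] C) →+ Φ.Ext ⊛[R] (C ⊛[R] C) :=
    map (M' := Φ.Ext) (R := R)
      { toFun := fun c => tmul R s c, map_add' := fun _ _ => tmul_add _ _ _,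
        map_smul' := fun _ _ => rfl } LinearMap.id
  have keyA (s : RightRes φ) (w : C ⊛[R] C) :
      assoc R R Φ.Ext C C (map Φ.extRightCoact.right LinearMap.id
        ((assoc R R (RightRes φ) C C).symm (tmul R s w))) =
      V s (assoc R R C C C (map (Coring.comul (R := R)).right LinearMap.id w)) := by
    induction w using induction_on with
    | h0 => simp only [map_zero, tmul_zero]
    | ht a b =>
      rw [assoc_symm_tmul, map_tmul, map_tmul, BimodHom.right_apply, BimodHom.right_apply,
        extRightCoact_tmul]
      generalize Coring.comul (R := R) a = z
      induction z using induction_on with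
      | h0 => simp only [map_zero, zero_tmul, tmul_zero]
      | ht m b => rfl
      | ha x y hx hy => simp only [map_add, add_tmul, tmul_add, hx, hy]
    | ha x y hx hy => simp only [map_add, tmul_add, hx, hy]
  have keyB (s : RightRes φ) (w : C ⊛[R] C) :
      map LinearMap.id (Coring.comul (R := R)).left
        ((assoc R R (RightRes φ) C C).symm (tmul R s w)) =
      V s (map LinearMap.id (Coring.comul (R := R)).left w) := by
    induction w using induction_on with
    | h0 => simp only [map_zero, tmul_zero]
    | ht a b => rfl
    | ha x y hx hy => simp only [map_add, tmul_add, hx, hy]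
  induction x using induction_on with
  | h0 => simp only [map_zero]
  | ht s c => rw [extRightCoact_tmul, keyA, keyB, Coring.coassoc]
  | ha x y hx hy => simp only [map_add, hx, hy]

theorem extRightCoact_counit (x : Φ.Ext) :
    rid R Φ.Ext (map LinearMap.id (Coring.counit (R := R) (C := C)).left (Φ.extRightCoact x)) =
      x := by
  have key (s : RightRes φ) (w : C ⊛[R] C) :
      rid R Φ.Ext (map LinearMap.id (Coring.counit (R := R) (C := C)).left
        ((assoc R R (RightRes φ) C C).symm (tmul R s w))) =
      tmul R s (rid R C (map LinearMap.id (Coring.counit (R := R) (C := C)).left w)) := by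
    induction w using induction_on with
    | h0 => simp only [map_zero, tmul_zero]
    | ht a b => rfl
    | ha x y hx hy => simp only [map_add, tmul_add, hx, hy]
  induction x using induction_on with
  | h0 => simp only [map_zero]
  | ht s c => rw [extRightCoact_tmul, key, Coring.comul_counit]
  | ha x y hx hy => simp only [map_add, hx, hy]

theorem tensorRightCoact_coassoc (x : N ⊛[S] Φ.Ext) :
    assoc R R _ C C (map (Φ.tensorRightCoact N) LinearMap.id (Φ.tensorRightCoact N x)) =
      map LinearMap.id (Coring.comul (R := R)).left (Φ.tensorRightCoact N x) := by
  let V (n : N) : Φ.Ext ⊛[R] (C ⊛[R] C) →+ (N ⊛[S] Φ.Ext) ⊛[R] (C ⊛[R] C) :=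
    map { toFun := fun l => tmul S n l, map_add' := fun _ _ => tmul_add _ _ _,
          map_smul' := fun _ _ => rfl } LinearMap.id
  have keyA (n : N) (w : Φ.Ext ⊛[R] C) :
      assoc R R _ C C (map (Φ.tensorRightCoact N) LinearMap.id
        ((assoc S R N Φ.Ext C).symm (tmul S n w))) =
      V n (assoc R R Φ.Ext C C (map Φ.extRightCoact.right LinearMap.id w)) := by
    induction w using induction_on with
    | h0 => simp only [map_zero, tmul_zero]
    | ht a b =>
      rw [assoc_symm_tmul, map_tmul, map_tmul, BimodHom.right_apply, tensorRightCoact_tmul]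
      generalize Φ.extRightCoact a = z
      induction z using induction_on with
      | h0 => simp only [map_zero, zero_tmul, tmul_zero]
      | ht m b => rfl
      | ha x y hx hy => simp only [map_add, add_tmul, tmul_add, hx, hy]
    | ha x y hx hy => simp only [map_add, tmul_add, hx, hy]
  have keyB (n : N) (w : Φ.Ext ⊛[R] C) :
      map LinearMap.id (Coring.comul (R := R)).left ((assoc S R N Φ.Ext C).symm (tmul S n w)) =
      V n (map LinearMap.id (Coring.comul (R := R)).left w) := by
    induction w using induction_on with
    | h0 => simp only [map_zero, tmul_zero]
    | ht a b => rfl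
    | ha x y hx hy => simp only [map_add, tmul_add, hx, hy]
  induction x using induction_on with
  | h0 => simp only [map_zero]
  | ht n l => rw [tensorRightCoact_tmul, keyA, keyB, extRightCoact_coassoc]
  | ha x y hx hy => simp only [map_add, hx, hy]

theorem tensorRightCoact_counit (x : N ⊛[S] Φ.Ext) :
    rid R _ (map LinearMap.id (Coring.counit (R := R) (C := C)).left (Φ.tensorRightCoact N x)) =
      x := by
  have key (n : N) (w : Φ.Ext ⊛[R] C) :
      rid R _ (map LinearMap.id (Coring.counit (R := R) (C := C)).left
        ((assoc S R N Φ.Ext C).symm (tmul S n w))) =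
      tmul S n (rid R _ (map LinearMap.id (Coring.counit (R := R) (C := C)).left w)) := by
    induction w using induction_on with
    | h0 => simp only [map_zero, tmul_zero]
    | ht a b => rfl
    | ha x y hx hy => simp only [map_add, tmul_add, hx, hy]
  induction x using induction_on with
  | h0 => simp only [map_zero]
  | ht n l => rw [tensorRightCoact_tmul, key, extRightCoact_counit]
  | ha x y hx hy => simp only [map_add, hx, hy]

/-- `f ⊗_S (S ⊗_R C)` is right `C`-colinear. -/
theorem tensorRightCoact_map (f : N →ₗ[Sᵐᵒᵖ] N') (x : N ⊛[S] Φ.Ext) :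
    Φ.tensorRightCoact N' (map f LinearMap.id x) =
      map (rTensor (B := R) Φ.Ext f) LinearMap.id (Φ.tensorRightCoact N x) := by
  have key (n : N) (w : Φ.Ext ⊛[R] C) :
      (assoc S R N' Φ.Ext C).symm (tmul S (f n) w) =
      map (rTensor (B := R) Φ.Ext f) LinearMap.id ((assoc S R N Φ.Ext C).symm (tmul S n w)) := by
    induction w using induction_on with
    | h0 => simp only [map_zero, tmul_zero]
    | ht a b => rfl
    | ha x y hx hy => simp only [map_add, tmul_add, hx, hy]
  induction x using induction_on with
  | h0 => simp only [map_zero]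
  | ht n l => rw [tensorRightCoact_tmul, map_tmul, tensorRightCoact_tmul, LinearMap.id_apply, key]
  | ha x y hx hy => simp only [map_add, hx, hy]

/-- The map `N ⊗_S (S ⊗_R C) → N`, `n ⊗ (s ⊗ c) ↦ n s φ(ε c)`. Its restriction to
`N □_D (S ⊗_R C)` is the counit of the adjunction, composed with `x ↦ x ⊗ 1`. -/
def evalExt (N : Type*) [AddCommGroup N] [Module Sᵐᵒᵖ N] : N ⊛[S] Φ.Ext →+ N :=
  (rid S N).comp (map LinearMap.id
    { lift (R := R) (fun (s : RightRes φ) (c : C) =>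
          (RightRes.of φ).symm s * φ (Coring.counit (R := R) c))
        (fun s s' c => by rw [map_add, add_mul])
        (fun s c c' => by rw [map_add, map_add, mul_add])
        (fun s r c => by
          obtain ⟨s, rfl⟩ := (RightRes.of φ).surjective s
          rw [BimodHom.map_lsmul, smul_eq_mul, map_mul, RightRes.of_smul,
            AddEquiv.symm_apply_apply, AddEquiv.symm_apply_apply, mul_assoc]) with
      map_smul' := fun a x => by
        induction x using induction_on with
        | h0 => simp
        | ht s c =>
          obtain ⟨s, rfl⟩ := (RightRes.of φ).surjective s
          exact mul_assoc a s _
        | ha x y hx hy =>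
          simp only [ZeroHom.toFun_eq_coe, AddMonoidHom.toZeroHom_coe] at hx hy ⊢
          simp only [smul_add, map_add, hx, hy] })

theorem evalExt_tmul (n : N) (s : S) (c : C) :
    Φ.evalExt N (tmul S n (tmul R (RightRes.of φ s) c)) =
      n <• (s * φ (Coring.counit (R := R) c)) := rfl

/-- Two additive maps on `N ⊗_S (S ⊗_R C)` agree if they agree on the elements `n ⊗ (1 ⊗ c)`. -/
theorem ext_congr {Q : Type*} [AddCommGroup Q] {f g : N ⊛[S] Φ.Ext →+ Q}
    (h : ∀ n c, f (tmul S n (Φ.oneTmul c)) = g (tmul S n (Φ.oneTmul c))) (x : N ⊛[S] Φ.Ext) :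
    f x = g x := by
  refine DFunLike.congr_fun (addHom_ext₃' fun n s c => ?_) x
  obtain ⟨s, rfl⟩ := (RightRes.of φ).surjective s
  have : (tmul R (RightRes.of φ s) c : Φ.Ext) = s • Φ.oneTmul c := by
    rw [oneTmul_apply, lsmul_tmul, RightRes.smul_of, mul_one]
  rw [this, ← smul_tmul, h]

theorem evalExt_oneTmul (n : N) (c : C) :
    Φ.evalExt N (tmul S n (Φ.oneTmul c)) = n <• φ (Coring.counit (R := R) c) := by
  rw [oneTmul_apply, evalExt_tmul, one_mul]

theorem evalExt_rsmul (x : N ⊛[S] Φ.Ext) (r : R) :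
    Φ.evalExt N (x <• r) = Φ.evalExt N x <• φ r :=
  Φ.ext_congr (f := (Φ.evalExt N).comp (rsmulHom (MulOpposite.op r)))
    (g := (AddMonoidHom.mk' (fun n : N => n <• φ r) (fun _ _ => smul_add _ _ _)).comp
      (Φ.evalExt N))
    (fun n c => by
      change Φ.evalExt N (tmul S n (Φ.oneTmul (c <• r))) = Φ.evalExt N _ <• φ r
      rw [evalExt_oneTmul, evalExt_oneTmul, BimodHom.map_rsmul, op_smul_eq_mul, map_mul,
        MulOpposite.op_mul, mul_smul]) x

/-- Applying `n ⊗ (s ⊗ c) ↦ n s φ(ε c)` to the first factor of the coaction of `N ⊗_S (S ⊗_R C)`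
removes `c₁` from `n ⊗ (1 ⊗ c₁) ⊗ c₂`: what remains is `n ⊗ g c`, by the counit axiom. -/
theorem mapSemi_evalExt_tensorRightCoact {P : Type*} [AddCommGroup P] [Module S P] (g : C →+ P)
    (hg : ∀ (r : R) (c : C), g (r • c) = φ r • g c) (n : N) (c : C) :
    mapSemi φ (Φ.evalExt N) g Φ.evalExt_rsmul hg
      (Φ.tensorRightCoact N (tmul S n (Φ.oneTmul c))) = tmul S n (g c) := by
  have key (w : C ⊛[R] C) : mapSemi φ (Φ.evalExt N) g Φ.evalExt_rsmul hg
      ((assoc S R N Φ.Ext C).symm (tmul S n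
        ((assoc R R (RightRes φ) C C).symm (tmul R (RightRes.of φ 1) w)))) =
      tmul S n (g (lid R C (map (Coring.counit (R := R) (C := C)).right LinearMap.id w))) := by
    induction w using induction_on with
    | h0 => simp only [map_zero, tmul_zero]
    | ht a b =>
      rw [assoc_symm_tmul, assoc_symm_tmul, mapSemi_tmul, evalExt_tmul, one_mul, smul_tmul,
        map_tmul, lid_tmul, hg]
      rfl
    | ha x y hx hy => simp only [map_add, tmul_add, hx, hy]
  rw [tensorRightCoact_tmul, oneTmul_apply, extRightCoact_tmul, key, Coring.counit_comul]

theorem mapSemi_evalExt_oneTmul (x : N ⊛[S] Φ.Ext) :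
    mapSemi φ (Φ.evalExt N) Φ.oneTmul Φ.evalExt_rsmul Φ.oneTmul_lsmul
      (Φ.tensorRightCoact N x) = x :=
  Φ.ext_congr
    (f := (mapSemi φ (Φ.evalExt N) Φ.oneTmul Φ.evalExt_rsmul Φ.oneTmul_lsmul).comp
      (Φ.tensorRightCoact N).toAddMonoidHom) (g := AddMonoidHom.id _)
    (Φ.mapSemi_evalExt_tensorRightCoact Φ.oneTmul Φ.oneTmul_lsmul) x

/-- On the cotensor product the map `evalExt` carries the coaction of `C` to that of `D`: apply
`n ⊗ (d ⊗ l) ↦ n ⊗ evalExt (d ⊗ l)` to both sides of the defining equation. -/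
theorem coact_evalExt (ρ : N →ₗ[Sᵐᵒᵖ] N ⊛[S] D) (x : N ⊛[S] Φ.Ext) (hx : x ∈ Φ.cotensor ρ) :
    ρ (Φ.evalExt N x) =
      mapSemi φ (Φ.evalExt N) Φ.toFun Φ.evalExt_rsmul Φ.map_lsmul (Φ.tensorRightCoact N x) := by
  -- `E` is `n ⊗ (d ⊗ l) ↦ n ⊗ evalExt (d ⊗ l)`.
  let E : N ⊛[S] (D ⊛[S] Φ.Ext) →+ N ⊛[S] D := map LinearMap.id
    { Φ.evalExt D with
      map_smul' := fun s y => Φ.ext_congr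
        (f := (Φ.evalExt D).comp (lsmulHom s))
        (g := (AddMonoidHom.mk' (fun d : D => s • d) (fun _ _ => smul_add _ _ _)).comp
          (Φ.evalExt D))
        (fun d c => by
          change Φ.evalExt D (tmul S (s • d) (Φ.oneTmul c)) = s • Φ.evalExt D _
          rw [evalExt_oneTmul, evalExt_oneTmul, ← smul_comm]) y }
  have hfst : E (Φ.cotensorFst ρ x) = ρ (Φ.evalExt N x) := by
    refine Φ.ext_congr (f := E.comp (Φ.cotensorFst ρ).toAddMonoidHom)
      (g := ρ.toAddMonoidHom.comp (Φ.evalExt N)) (fun n c => ?_) x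
    change E (assoc S S N D Φ.Ext (tmul S (ρ n) (Φ.oneTmul c))) = ρ (Φ.evalExt N _)
    rw [evalExt_oneTmul, map_smul]
    generalize ρ n = z
    induction z using induction_on with
    | h0 => simp only [map_zero, zero_tmul, smul_zero]
    | ht m d =>
      rw [assoc_tmul, rsmul_tmul]
      change tmul S m (Φ.evalExt D (tmul S d (Φ.oneTmul c))) = _
      rw [evalExt_oneTmul]
    | ha x y hx hy => simp only [map_add, add_tmul, smul_add, hx, hy]
  have hsnd : E (Φ.cotensorSnd N x) =
      mapSemi φ (Φ.evalExt N) Φ.toFun Φ.evalExt_rsmul Φ.map_lsmul (Φ.tensorRightCoact N x) := by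
    refine Φ.ext_congr (f := E.comp (Φ.cotensorSnd N).toAddMonoidHom)
      (g := (mapSemi φ (Φ.evalExt N) Φ.toFun Φ.evalExt_rsmul Φ.map_lsmul).comp
        (Φ.tensorRightCoact N).toAddMonoidHom) (fun n c => ?_) x
    refine Eq.trans ?_ (Φ.mapSemi_evalExt_tensorRightCoact Φ.toFun Φ.map_lsmul n c).symm
    have key (w : C ⊛[R] C) : Φ.evalExt D (Φ.extendLeft w) =
        Φ.toFun (rid R C (map LinearMap.id (Coring.counit (R := R) (C := C)).left w)) := by
      induction w using induction_on with
      | h0 => simp only [map_zero]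
      | ht a b =>
        rw [map_tmul, rid_tmul, Φ.map_rsmul]
        exact Φ.evalExt_oneTmul _ _
      | ha x y hx hy => simp only [map_add, hx, hy]
    change tmul S n (Φ.evalExt D ((1 : S) • Φ.extendLeft (Coring.comul (R := R) c))) = _
    rw [one_smul, key, Coring.comul_counit]
  rw [← hfst, ← hsnd]
  exact congrArg E hx

end

end Tensor

section Transpose

variable {R S : Type*} [Ring R] [Ring S] {φ : R →+* S} {C D : Type*}
  [AddCommGroup C] [Module R C] [Module Rᵐᵒᵖ C] [SMulCommClass R Rᵐᵒᵖ C] [Coring R C]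
  [AddCommGroup D] [Module S D] [Module Sᵐᵒᵖ D] [SMulCommClass S Sᵐᵒᵖ D] [Coring S D]
  (Φ : CoringHom φ C D)
variable {M N N' : Type*} [AddCommGroup M] [Module Rᵐᵒᵖ M] [AddCommGroup N] [Module Sᵐᵒᵖ N]
  [AddCommGroup N'] [Module Sᵐᵒᵖ N']

theorem cotensorFst_map {ρ : N →ₗ[Sᵐᵒᵖ] N ⊛[S] D} {ρ' : N' →ₗ[Sᵐᵒᵖ] N' ⊛[S] D}
    (f : N →ₗ[Sᵐᵒᵖ] N') (hf : ∀ n, ρ' (f n) = map f LinearMap.id (ρ n)) (x : N ⊛[S] Φ.Ext) :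
    Φ.cotensorFst ρ' (map f LinearMap.id x) = map f LinearMap.id (Φ.cotensorFst ρ x) := by
  refine addHom_congr (f := (Φ.cotensorFst ρ').toAddMonoidHom.comp (map f LinearMap.id))
    (g := (map f LinearMap.id).comp (Φ.cotensorFst ρ).toAddMonoidHom) (fun n l => ?_) x
  change assoc S S N' D Φ.Ext (tmul S (ρ' (f n)) l) =
    map f LinearMap.id (assoc S S N D Φ.Ext (tmul S (ρ n) l))
  rw [hf, ← assoc_map_map]
  rfl

theorem map_mem_cotensor {ρ : N →ₗ[Sᵐᵒᵖ] N ⊛[S] D} {ρ' : N' →ₗ[Sᵐᵒᵖ] N' ⊛[S] D}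
    (f : N →ₗ[Sᵐᵒᵖ] N') (hf : ∀ n, ρ' (f n) = map f LinearMap.id (ρ n)) {x : N ⊛[S] Φ.Ext}
    (hx : x ∈ Φ.cotensor ρ) : map f LinearMap.id x ∈ Φ.cotensor ρ' := by
  change Φ.cotensorFst ρ' _ = map LinearMap.id _ _
  rw [cotensorFst_map Φ f hf, ← map_comm]
  exact congrArg (map f LinearMap.id) hx

/-- `f □_D (S ⊗_R C)` for a `D`-colinear map `f`. -/
def cotensorMap {ρ : N →ₗ[Sᵐᵒᵖ] N ⊛[S] D} {ρ' : N' →ₗ[Sᵐᵒᵖ] N' ⊛[S] D}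
    (f : N →ₗ[Sᵐᵒᵖ] N') (hf : ∀ n, ρ' (f n) = map f LinearMap.id (ρ n)) :
    Φ.cotensor ρ →ₗ[Rᵐᵒᵖ] Φ.cotensor ρ' where
  toFun x := ⟨map f LinearMap.id x.1, Φ.map_mem_cotensor f hf x.2⟩
  map_add' x y := Subtype.ext (map_add (map f LinearMap.id) x.1 y.1)
  map_smul' r x := Subtype.ext ((rTensor (B := R) Φ.Ext f).map_smul r x.1)

theorem cotensorMap_colinear {ρ : N →ₗ[Sᵐᵒᵖ] N ⊛[S] D} {ρ' : N' →ₗ[Sᵐᵒᵖ] N' ⊛[S] D}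
    (f : N →ₗ[Sᵐᵒᵖ] N') (hf : ∀ n, ρ' (f n) = map f LinearMap.id (ρ n))
    (h : LeftModulePreservesEqualizer C (Φ.cotensorFst ρ) (Φ.cotensorSnd N))
    (h' : LeftModulePreservesEqualizer C (Φ.cotensorFst ρ') (Φ.cotensorSnd N'))
    (x : Φ.cotensor ρ) :
    Φ.cotensorRightCoact ρ' h' (Φ.cotensorMap f hf x) =
      map (Φ.cotensorMap f hf) LinearMap.id (Φ.cotensorRightCoact ρ h x) :=
  h'.1 (by
    have hs : (Φ.cotensor ρ').subtype.comp (Φ.cotensorMap f hf) =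
        (rTensor (B := R) Φ.Ext f).comp (Φ.cotensor ρ).subtype := rfl
    rw [cotensorRightCoact_spec, map_map, hs, ← map_map _ _ _ LinearMap.id,
      cotensorRightCoact_spec]
    exact Φ.tensorRightCoact_map f x.1)

/-- The restriction `m ↦ u (m ⊗ 1)` of a map `u : M ⊗_R S → N`. -/
def restr (u : M ⊛[R] LeftRes φ →ₗ[Sᵐᵒᵖ] N) : M →+ N :=
  u.toAddMonoidHom.comp (tmulOne φ M)

theorem restr_apply (u : M ⊛[R] LeftRes φ →ₗ[Sᵐᵒᵖ] N) (m : M) :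
    restr u m = u (tmul R m (LeftRes.of φ 1)) := rfl

theorem restr_rsmul (u : M ⊛[R] LeftRes φ →ₗ[Sᵐᵒᵖ] N) (m : M) (r : R) :
    restr u (m <• r) = restr u m <• φ r :=
  (congrArg u (tmulOne_rsmul m r)).trans (u.map_smul _ _)

/-- For `u : M ⊗_R S → N`, the map `M ⊗_R C → N ⊗_S (S ⊗_R C)`, `m ⊗ c ↦ u (m ⊗ 1) ⊗ (1 ⊗ c)`. -/
def extendRight (u : M ⊛[R] LeftRes φ →ₗ[Sᵐᵒᵖ] N) : M ⊛[R] C →ₗ[Rᵐᵒᵖ] N ⊛[S] Φ.Ext :=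
  { mapSemi φ (restr u) Φ.oneTmul (restr_rsmul u) Φ.oneTmul_lsmul with
    map_smul' := fun r x => mapSemi_rsmul _ _ _ _ _ r.unop r.unop (fun _ => rfl) x }

theorem extendRight_tmul (u : M ⊛[R] LeftRes φ →ₗ[Sᵐᵒᵖ] N) (m : M) (c : C) :
    Φ.extendRight u (tmul R m c) = tmul S (restr u m) (Φ.oneTmul c) := rfl

/-- Both sides of the defining equation of the cotensor product are
`u (m₀ ⊗ 1) ⊗ (Φ m₁ ⊗ (1 ⊗ m₂))`, by colinearity of `u` and coassociativity. -/
theorem extendRight_mem {ρ : M →ₗ[Rᵐᵒᵖ] M ⊛[R] C} {σ : N →ₗ[Sᵐᵒᵖ] N ⊛[S] D}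
    (hρ : ∀ m, assoc R R M C C (map ρ LinearMap.id (ρ m)) =
      map LinearMap.id (Coring.comul (R := R)).left (ρ m))
    (u : M ⊛[R] LeftRes φ →ₗ[Sᵐᵒᵖ] N)
    (hu : ∀ x, σ (u x) = map u LinearMap.id (Φ.indCoact ρ x)) (m : M) :
    Φ.extendRight u (ρ m) ∈ Φ.cotensor σ := by
  let T : M ⊛[R] (C ⊛[R] C) →+ N ⊛[S] (D ⊛[S] Φ.Ext) :=
    mapSemi φ (restr u) Φ.extendLeft (restr_rsmul u) Φ.extendLeft_lsmul
  have keyA (y : M ⊛[R] C) : Φ.cotensorFst σ (Φ.extendRight u y) =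
      T (assoc R R M C C (map ρ LinearMap.id y)) := by
    induction y using induction_on with
    | h0 => simp only [map_zero]
    | ht a b =>
      rw [extendRight_tmul, cotensorFst_apply, map_tmul, map_tmul, restr_apply, hu, indCoact_one]
      generalize ρ a = z
      induction z using induction_on with
      | h0 => simp only [map_zero, zero_tmul]
      | ht m b => rfl
      | ha x y hx hy => simp only [map_add, add_tmul, hx, hy]
    | ha x y hx hy => simp only [map_add, hx, hy]
  have keyB (y : M ⊛[R] C) : Φ.cotensorSnd N (Φ.extendRight u y) =
      T (map LinearMap.id (Coring.comul (R := R)).left y) := by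
    induction y using induction_on with
    | h0 => simp only [map_zero]
    | ht a b =>
      rw [cotensorSnd_apply, extendRight_tmul, map_tmul, map_tmul, oneTmul_apply,
        BimodHom.left_apply, extLeftCoact_tmul, one_smul]
      rfl
    | ha x y hx hy => simp only [map_add, hx, hy]
  exact (keyA _).trans ((congrArg T (hρ m)).trans (keyB _).symm)

/-- The map `M → N □_D (S ⊗_R C)`, `m ↦ u (m₀ ⊗ 1) ⊗ (1 ⊗ m₁)`, for a `D`-colinear map
`u : M ⊗_R S → N`. -/
def transposeLinear {ρ : M →ₗ[Rᵐᵒᵖ] M ⊛[R] C} {σ : N →ₗ[Sᵐᵒᵖ] N ⊛[S] D}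
    (hρ : ∀ m, assoc R R M C C (map ρ LinearMap.id (ρ m)) =
      map LinearMap.id (Coring.comul (R := R)).left (ρ m))
    (u : M ⊛[R] LeftRes φ →ₗ[Sᵐᵒᵖ] N)
    (hu : ∀ x, σ (u x) = map u LinearMap.id (Φ.indCoact ρ x)) : M →ₗ[Rᵐᵒᵖ] Φ.cotensor σ :=
  ((Φ.extendRight u).comp ρ).codRestrict _ (Φ.extendRight_mem hρ u hu)

theorem transposeLinear_colinear {ρ : M →ₗ[Rᵐᵒᵖ] M ⊛[R] C} {σ : N →ₗ[Sᵐᵒᵖ] N ⊛[S] D}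
    (hρ : ∀ m, assoc R R M C C (map ρ LinearMap.id (ρ m)) =
      map LinearMap.id (Coring.comul (R := R)).left (ρ m))
    (u : M ⊛[R] LeftRes φ →ₗ[Sᵐᵒᵖ] N)
    (hu : ∀ x, σ (u x) = map u LinearMap.id (Φ.indCoact ρ x))
    (h : LeftModulePreservesEqualizer C (Φ.cotensorFst σ) (Φ.cotensorSnd N)) (m : M) :
    Φ.cotensorRightCoact σ h (Φ.transposeLinear hρ u hu m) =
      map (Φ.transposeLinear hρ u hu) LinearMap.id (ρ m) := by
  let V : C ⊛[R] C →+ Φ.Ext ⊛[R] C := map (M' := Φ.Ext) (R := R)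
    { Φ.oneTmul with map_smul' := fun _ _ => rfl } LinearMap.id
  let T : M ⊛[R] (C ⊛[R] C) →+ (N ⊛[S] Φ.Ext) ⊛[R] C :=
    (assoc S R N Φ.Ext C).symm.toAddMonoidHom.comp
      (mapSemi φ (restr u) V (restr_rsmul u)
        (fun r y => mapSemi_lsmul _ _ _ _ _ r (φ r) (Φ.oneTmul_lsmul r) y))
  have keyA (y : M ⊛[R] C) : Φ.tensorRightCoact N (Φ.extendRight u y) =
      T (map LinearMap.id (Coring.comul (R := R)).left y) := by
    induction y using induction_on with
    | h0 => simp only [map_zero]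
    | ht a b =>
      rw [extendRight_tmul, tensorRightCoact_tmul, oneTmul_apply, extRightCoact_tmul, map_tmul,
        BimodHom.left_apply]
      generalize Coring.comul (R := R) b = w
      induction w using induction_on with
      | h0 => simp only [map_zero, tmul_zero]
      | ht a b => rfl
      | ha x y hx hy => simp only [map_add, tmul_add, hx, hy]
    | ha x y hx hy => simp only [map_add, hx, hy]
  have keyB (y : M ⊛[R] C) : map ((Φ.extendRight u).comp ρ) LinearMap.id y =
      T (assoc R R M C C (map ρ LinearMap.id y)) := by
    induction y using induction_on with
    | h0 => simp only [map_zero]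
    | ht a b =>
      rw [map_tmul, map_tmul, LinearMap.comp_apply]
      generalize ρ a = z
      induction z using induction_on with
      | h0 => simp only [map_zero, zero_tmul]
      | ht m b => rfl
      | ha x y hx hy => simp only [map_add, add_tmul, hx, hy]
    | ha x y hx hy => simp only [map_add, hx, hy]
  refine h.1 ?_
  rw [cotensorRightCoact_spec, map_map]
  exact (keyA _).trans ((congrArg T (hρ m)).symm.trans (keyB _).symm)

/-- The map `M ⊗_R S → N`, `m ⊗ s ↦ evalExt (g m) s`, for a map `g : M → N ⊗_S (S ⊗_R C)`. -/
def untransposeLinear (g : M →ₗ[Rᵐᵒᵖ] N ⊛[S] Φ.Ext) : M ⊛[R] LeftRes φ →ₗ[Sᵐᵒᵖ] N :=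
  { lift (R := R) (fun m (s : LeftRes φ) => Φ.evalExt N (g m) <• (LeftRes.of φ).symm s)
      (fun m m' s => by rw [map_add, map_add, smul_add])
      (fun m s s' => by rw [map_add, MulOpposite.op_add, add_smul])
      (fun m r s => by
        obtain ⟨s, rfl⟩ := (LeftRes.of φ).surjective s
        rw [g.map_smul, evalExt_rsmul, LeftRes.smul_of,
          AddEquiv.symm_apply_apply, AddEquiv.symm_apply_apply, MulOpposite.op_mul,
          mul_smul]) with
    map_smul' := fun t x => by
      obtain ⟨t, rfl⟩ := MulOpposite.op_surjective t
      induction x using induction_on with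
      | h0 => simp
      | ht m s =>
        obtain ⟨s, rfl⟩ := (LeftRes.of φ).surjective s
        simp [rsmul_tmul, LeftRes.of_smul, mul_smul]
      | ha x y hx hy =>
        simp only [ZeroHom.toFun_eq_coe, AddMonoidHom.toZeroHom_coe] at hx hy ⊢
        simp only [smul_add, map_add, hx, hy] }

theorem untransposeLinear_tmul (g : M →ₗ[Rᵐᵒᵖ] N ⊛[S] Φ.Ext) (m : M) (s : S) :
    Φ.untransposeLinear g (tmul R m (LeftRes.of φ s)) = Φ.evalExt N (g m) <• s := rfl

theorem restr_untransposeLinear (g : M →ₗ[Rᵐᵒᵖ] N ⊛[S] Φ.Ext) (m : M) :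
    restr (Φ.untransposeLinear g) m = Φ.evalExt N (g m) := by
  rw [restr_apply, untransposeLinear_tmul, MulOpposite.op_one, one_smul]

theorem untransposeLinear_colinear {ρ : M →ₗ[Rᵐᵒᵖ] M ⊛[R] C} {σ : N →ₗ[Sᵐᵒᵖ] N ⊛[S] D}
    (g : M →ₗ[Rᵐᵒᵖ] N ⊛[S] Φ.Ext) (hmem : ∀ m, g m ∈ Φ.cotensor σ)
    (hg : ∀ m, Φ.tensorRightCoact N (g m) = map g LinearMap.id (ρ m)) (x : M ⊛[R] LeftRes φ) :
    σ (Φ.untransposeLinear g x) =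
      map (Φ.untransposeLinear g) LinearMap.id (Φ.indCoact ρ x) := by
  induction x using induction_on with
  | h0 => simp only [map_zero]
  | ht m s =>
    obtain ⟨s, rfl⟩ := (LeftRes.of φ).surjective s
    have key (y : M ⊛[R] C) :
        mapSemi φ (Φ.evalExt N) Φ.toFun Φ.evalExt_rsmul Φ.map_lsmul (map g LinearMap.id y) =
        map (Φ.untransposeLinear g) LinearMap.id (Φ.extend M y) := by
      induction y using induction_on with
      | h0 => simp only [map_zero]
      | ht m c =>
        rw [extend_tmul, map_tmul, map_tmul, mapSemi_tmul, untransposeLinear_tmul,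
          MulOpposite.op_one, one_smul]
        rfl
      | ha x y hx hy => simp only [map_add, hx, hy]
    rw [untransposeLinear_tmul, map_smul, coact_evalExt Φ σ _ (hmem m), hg, key, indCoact_tmul,
      BalTensor.map_rsmul _ _ _ (fun _ => rfl)]
  | ha x y hx hy => simp only [map_add, hx, hy]

theorem untransposeLinear_extendRight {ρ : M →ₗ[Rᵐᵒᵖ] M ⊛[R] C}
    (hρ : ∀ m, rid R M (map LinearMap.id (Coring.counit (R := R) (C := C)).left (ρ m)) = m)
    (u : M ⊛[R] LeftRes φ →ₗ[Sᵐᵒᵖ] N) (x : M ⊛[R] LeftRes φ) :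
    Φ.untransposeLinear ((Φ.extendRight u).comp ρ) x = u x := by
  refine addHom_congr (f := (Φ.untransposeLinear ((Φ.extendRight u).comp ρ)).toAddMonoidHom)
    (g := u.toAddMonoidHom) (fun m s => ?_) x
  obtain ⟨s, rfl⟩ := (LeftRes.of φ).surjective s
  have key (y : M ⊛[R] C) : Φ.evalExt N (Φ.extendRight u y) =
      restr u (rid R M (map LinearMap.id (Coring.counit (R := R) (C := C)).left y)) := by
    induction y using induction_on with
    | h0 => simp only [map_zero]
    | ht m c =>
      rw [extendRight_tmul, evalExt_oneTmul, map_tmul, rid_tmul, restr_rsmul]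
      rfl
    | ha x y hx hy => simp only [map_add, hx, hy]
  change Φ.untransposeLinear ((Φ.extendRight u).comp ρ) (tmul R m (LeftRes.of φ s)) =
    u (tmul R m (LeftRes.of φ s))
  rw [untransposeLinear_tmul, LinearMap.comp_apply, key, hρ, restr_apply, ← map_smul, rsmul_tmul,
    LeftRes.of_smul, one_mul]

theorem extendRight_untransposeLinear {ρ : M →ₗ[Rᵐᵒᵖ] M ⊛[R] C}
    (g : M →ₗ[Rᵐᵒᵖ] N ⊛[S] Φ.Ext)
    (hg : ∀ m, Φ.tensorRightCoact N (g m) = map g LinearMap.id (ρ m)) (m : M) :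
    Φ.extendRight (Φ.untransposeLinear g) (ρ m) = g m := by
  have key (y : M ⊛[R] C) : Φ.extendRight (Φ.untransposeLinear g) y =
      mapSemi φ (Φ.evalExt N) Φ.oneTmul Φ.evalExt_rsmul Φ.oneTmul_lsmul
        (map g LinearMap.id y) := by
    induction y using induction_on with
    | h0 => simp only [map_zero]
    | ht m c =>
      rw [extendRight_tmul, restr_untransposeLinear, map_tmul, mapSemi_tmul]
      rfl
    | ha x y hx hy => simp only [map_add, hx, hy]
  rw [key, ← hg, mapSemi_evalExt_oneTmul]

end Transpose

section Adjunction

variable {R S : Type u} [Ring R] [Ring S] {φ : R →+* S} {C D : Type u}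
  [AddCommGroup C] [Module R C] [Module Rᵐᵒᵖ C] [SMulCommClass R Rᵐᵒᵖ C] [Coring R C]
  [AddCommGroup D] [Module S D] [Module Sᵐᵒᵖ D] [SMulCommClass S Sᵐᵒᵖ D] [Coring S D]
  (Φ : CoringHom φ C D)

/-- The right `C`-comodule `N □_D (S ⊗_R C)`. Coassociativity can be checked in
`(N ⊗_S (S ⊗_R C)) ⊗_R (C ⊗_R C)`, because `C ⊗_R C` preserves the defining equalizer. -/
def cotensorComodule (N : RightComodule S D)
    (h : LeftModulePreservesEqualizer (C ⊛[R] C) (Φ.cotensorFst N.coact) (Φ.cotensorSnd N)) :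
    RightComodule R C where
  carrier := Φ.cotensor N.coact
  coact := Φ.cotensorRightCoact N.coact h.of_tensor
  coassoc x := h.1 (by
    have hs : (rTensor (B := R) C (Φ.cotensor N.coact).subtype).comp
        (Φ.cotensorRightCoact N.coact h.of_tensor) =
        (Φ.tensorRightCoact N).comp (Φ.cotensor N.coact).subtype :=
      LinearMap.ext (Φ.cotensorRightCoact_spec N.coact h.of_tensor)
    rw [← assoc_map_map, map_map, hs, map_comm, cotensorRightCoact_spec,
      ← tensorRightCoact_coassoc, ← cotensorRightCoact_spec, map_map])
  counit x := Subtype.ext (by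
    refine (rid_map (Φ.cotensor N.coact).subtype _).symm.trans ?_
    rw [map_comm, cotensorRightCoact_spec, tensorRightCoact_counit])

variable (h : ∀ N : RightComodule S D,
  LeftModulePreservesEqualizer (C ⊛[R] C) (Φ.cotensorFst N.coact) (Φ.cotensorSnd N))

/-- The functor `N ↦ N □_D (S ⊗_R C)`, right adjoint to the induction functor. -/
def cotensorFunctor : RightComodule S D ⥤ RightComodule R C where
  obj N := Φ.cotensorComodule N (h N)
  map {N N'} f := RightComodule.Hom.mk (M := Φ.cotensorComodule N (h N))
    (N := Φ.cotensorComodule N' (h N'))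
    (Φ.cotensorMap (RightComodule.Hom.toLinearMap f) (RightComodule.Hom.colinear f))
    (Φ.cotensorMap_colinear (RightComodule.Hom.toLinearMap f) (RightComodule.Hom.colinear f)
      (h N).of_tensor (h N').of_tensor)
  map_id N := RightComodule.hom_ext fun (x : Φ.cotensor N.coact) =>
    Subtype.ext (map_id_id x.1)
  map_comp {N _ _} f g := RightComodule.hom_ext fun (x : Φ.cotensor N.coact) =>
    Subtype.ext (map_map (RightComodule.Hom.toLinearMap f) LinearMap.id
      (RightComodule.Hom.toLinearMap g) LinearMap.id x.1).symm

section

variable {M : RightComodule R C} {N : RightComodule S D}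

/-- The colinear map `M → N □_D (S ⊗_R C)` corresponding to a colinear map `M ⊗_R S → N`. -/
def transpose (u : (inductionFunctor Φ).obj M ⟶ N) : M ⟶ (Φ.cotensorFunctor h).obj N :=
  RightComodule.Hom.mk (N := (Φ.cotensorFunctor h).obj N)
    (Φ.transposeLinear M.coassoc (RightComodule.Hom.toLinearMap u) (RightComodule.Hom.colinear u))
    (Φ.transposeLinear_colinear M.coassoc (RightComodule.Hom.toLinearMap u)
      (RightComodule.Hom.colinear u) (h N).of_tensor)

/-- A colinear map into `N □_D (S ⊗_R C)`, composed with the inclusion. -/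
def toTensor (g : M ⟶ (Φ.cotensorFunctor h).obj N) : M →ₗ[Rᵐᵒᵖ] N ⊛[S] Φ.Ext :=
  (Φ.cotensor N.coact).subtype.comp (RightComodule.Hom.toLinearMap g)

theorem toTensor_colinear (g : M ⟶ (Φ.cotensorFunctor h).obj N) (m : M) :
    Φ.tensorRightCoact N (Φ.toTensor h g m) =
      map (Φ.toTensor h g) LinearMap.id (M.coact m) := by
  refine (Φ.cotensorRightCoact_spec N.coact (h N).of_tensor _).symm.trans ?_
  refine (congrArg _ (RightComodule.Hom.colinear g m)).trans ?_
  exact map_map (RightComodule.Hom.toLinearMap g) LinearMap.id (Φ.cotensor N.coact).subtype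
    LinearMap.id _

/-- The colinear map `M ⊗_R S → N` corresponding to a colinear map `M → N □_D (S ⊗_R C)`. -/
def untranspose (g : M ⟶ (Φ.cotensorFunctor h).obj N) : (inductionFunctor Φ).obj M ⟶ N :=
  RightComodule.Hom.mk (M := (inductionFunctor Φ).obj M) (Φ.untransposeLinear (Φ.toTensor h g))
    (Φ.untransposeLinear_colinear (Φ.toTensor h g)
      (fun m => (RightComodule.Hom.toLinearMap g m : Φ.cotensor N.coact).2)
      (Φ.toTensor_colinear h g))

end

/-- The induction functor `- ⊗_R S` is left adjoint to `- □_D (S ⊗_R C)`. -/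
def inductionAdjunction : inductionFunctor Φ ⊣ Φ.cotensorFunctor h :=
  Adjunction.mkOfHomEquiv
    { homEquiv := fun M N =>
        { toFun := Φ.transpose h
          invFun := Φ.untranspose h
          left_inv := fun u => RightComodule.hom_ext
            (Φ.untransposeLinear_extendRight M.counit (RightComodule.Hom.toLinearMap u))
          right_inv := fun g => RightComodule.hom_ext fun m => Subtype.ext
            (Φ.extendRight_untransposeLinear (Φ.toTensor h g) (Φ.toTensor_colinear h g) m) }
      homEquiv_naturality_left_symm := fun {M' M N} f g => by
        refine RightComodule.hom_ext fun x => ?_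
        exact addHom_congr (R := R) (M := M') (N := LeftRes φ)
          (f := (RightComodule.Hom.toLinearMap (Φ.untranspose h (f ≫ g))).toAddMonoidHom)
          (g := (RightComodule.Hom.toLinearMap
            ((inductionFunctor Φ).map f ≫ Φ.untranspose h g)).toAddMonoidHom)
          (fun m s => rfl) x
      homEquiv_naturality_right := fun {M N N'} u f => by
        refine RightComodule.hom_ext fun m => Subtype.ext ?_
        refine addHom_congr (R := R) (M := M) (N := C)
          (f := (Φ.extendRight (RightComodule.Hom.toLinearMap (u ≫ f))).toAddMonoidHom)
          (g := (map (RightComodule.Hom.toLinearMap f) LinearMap.id).comp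
            (Φ.extendRight (RightComodule.Hom.toLinearMap u)).toAddMonoidHom)
          (fun m c => rfl) (M.coact m) }

/-- At the comodule `C` the unit of the adjunction is `η_C`. -/
theorem inductionAdjunction_unit_self (c : C) :
    RightComodule.Hom.toLinearMap
      ((Φ.inductionAdjunction h).unit.app (RightComodule.self R C)) c = Φ.unit c := rfl

end Adjunction
end CoringHom

/-! ### Cofree comodules -/

namespace RightComodule

variable {R : Type u} [Ring R] {C : Type u} [AddCommGroup C] [Module R C]
    [Module Rᵐᵒᵖ C] [SMulCommClass R Rᵐᵒᵖ C] [Coring R C]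

section

variable {M M' : Type u} [AddCommGroup M] [Module Rᵐᵒᵖ M] [AddCommGroup M'] [Module Rᵐᵒᵖ M']

/-- The map `c ↦ m ⊗ c`. -/
def insert (m : M) : C →ₗ[Rᵐᵒᵖ] M ⊛[R] C where
  toFun c := tmul R m c
  map_add' _ _ := tmul_add _ _ _
  map_smul' _ _ := rfl

/-- The coaction `M ⊗_R Δ` of `M ⊗_R C`. -/
def cofreeCoact (R : Type u) [Ring R] (C : Type u) [AddCommGroup C] [Module R C] [Module Rᵐᵒᵖ C]
    [SMulCommClass R Rᵐᵒᵖ C] [Coring R C] (M : Type u) [AddCommGroup M] [Module Rᵐᵒᵖ M] :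
    M ⊛[R] C →ₗ[Rᵐᵒᵖ] (M ⊛[R] C) ⊛[R] C :=
  { (assoc R R M C C).symm.toAddMonoidHom.comp
      (map (LinearMap.id : M →ₗ[Rᵐᵒᵖ] M) (Coring.comul (R := R) (C := C)).left) with
    map_smul' := fun r x => by
      obtain ⟨r, rfl⟩ := MulOpposite.op_surjective r
      change (assoc R R M C C).symm (map _ _ (x <• r)) = _
      rw [BalTensor.map_rsmul _ _ _ (fun c => Coring.comul.map_rsmul c r), assoc_symm_rsmul]
      rfl }

theorem cofreeCoact_tmul (m : M) (c : C) :
    cofreeCoact R C M (tmul R m c) =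
      map (insert m) LinearMap.id (Coring.comul (R := R) c) := by
  change (assoc R R M C C).symm (tmul R m (Coring.comul (R := R) c)) = _
  generalize Coring.comul (R := R) c = z
  induction z using induction_on with
  | h0 => simp only [map_zero, tmul_zero]
  | ht a b => rfl
  | ha x y hx hy => simp only [map_add, tmul_add, hx, hy]

theorem cofreeCoact_coassoc (x : M ⊛[R] C) :
    assoc R R _ C C (map (cofreeCoact R C M) LinearMap.id (cofreeCoact R C M x)) =
      map LinearMap.id (Coring.comul (R := R)).left (cofreeCoact R C M x) := by
  have keyA (m : M) (y : C ⊛[R] C) :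
      assoc R R _ C C (map (cofreeCoact R C M) LinearMap.id (map (insert m) LinearMap.id y)) =
      map (insert m) LinearMap.id
        (assoc R R C C C (map (Coring.comul (R := R)).right LinearMap.id y)) := by
    induction y using induction_on with
    | h0 => simp only [map_zero]
    | ht a b =>
      rw [map_tmul, map_tmul, map_tmul, ← assoc_map_map, map_tmul]
      exact congrArg (fun z => assoc R R _ C C (tmul R z b)) (cofreeCoact_tmul m a)
    | ha x y hx hy => simp only [map_add, hx, hy]
  induction x using induction_on with
  | h0 => simp only [map_zero]
  | ht m c => rw [cofreeCoact_tmul, keyA, Coring.coassoc, map_comm]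
  | ha x y hx hy => simp only [map_add, hx, hy]

theorem cofreeCoact_counit (x : M ⊛[R] C) :
    rid R _ (map LinearMap.id (Coring.counit (R := R) (C := C)).left (cofreeCoact R C M x)) = x := by
  induction x using induction_on with
  | h0 => simp only [map_zero]
  | ht m c =>
    rw [cofreeCoact_tmul, ← map_comm, rid_map, Coring.comul_counit]
    rfl
  | ha x y hx hy => simp only [map_add, hx, hy]

/-- The cofree right `C`-comodule `M ⊗_R C` on a right `R`-module `M`. -/
def cofree (R : Type u) [Ring R] (C : Type u) [AddCommGroup C] [Module R C] [Module Rᵐᵒᵖ C]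
    [SMulCommClass R Rᵐᵒᵖ C] [Coring R C] (M : Type u) [AddCommGroup M] [Module Rᵐᵒᵖ M] :
    RightComodule R C where
  carrier := M ⊛[R] C
  coact := cofreeCoact R C M
  coassoc := cofreeCoact_coassoc
  counit := cofreeCoact_counit

/-- `f ⊗_R C` as a map of cofree comodules. -/
def cofreeMap (C : Type u) [AddCommGroup C] [Module R C] [Module Rᵐᵒᵖ C]
    [SMulCommClass R Rᵐᵒᵖ C] [Coring R C] (f : M →ₗ[Rᵐᵒᵖ] M') : cofree R C M ⟶ cofree R C M' :=
  Hom.mk (M := cofree R C M) (N := cofree R C M') (rTensor (B := R) C f) fun (x : M ⊛[R] C) => by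
    change cofreeCoact R C M' (rTensor (B := R) C f x) =
      map (rTensor (B := R) C f) LinearMap.id (cofreeCoact R C M x)
    induction x using induction_on with
    | h0 => simp only [map_zero]
    | ht m c =>
      rw [cofreeCoact_tmul, map_map]
      exact cofreeCoact_tmul (f m) c
    | ha x y hx hy => simp only [map_add, hx, hy]

/-- The map `C → M ⊗_R C`, `c ↦ m ⊗ c`, of right comodules. -/
def insertHom (C : Type u) [AddCommGroup C] [Module R C] [Module Rᵐᵒᵖ C]
    [SMulCommClass R Rᵐᵒᵖ C] [Coring R C] (m : M) : self R C ⟶ cofree R C M :=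
  Hom.mk (M := self R C) (N := cofree R C M) (insert m : C →ₗ[Rᵐᵒᵖ] M ⊛[R] C)
    (cofreeCoact_tmul (C := C) m)

theorem insertHom_comp_cofreeMap (m : M) (f : M →ₗ[Rᵐᵒᵖ] M') :
    insertHom C m ≫ cofreeMap C f = insertHom C (f m) := rfl

/-- The map `m ⊗ c ↦ m ε(c)`. -/
def counitMap (R : Type u) [Ring R] (C : Type u) [AddCommGroup C] [Module R C] [Module Rᵐᵒᵖ C]
    [SMulCommClass R Rᵐᵒᵖ C] [Coring R C] (M : Type u) [AddCommGroup M] [Module Rᵐᵒᵖ M] :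
    M ⊛[R] C →ₗ[Rᵐᵒᵖ] M :=
  { (rid R M).comp (map LinearMap.id (Coring.counit (R := R) (C := C)).left) with
    map_smul' := fun r x => by
      obtain ⟨r, rfl⟩ := MulOpposite.op_surjective r
      change rid R M (map _ _ (x <• r)) = rid R M (map _ _ x) <• r
      induction x using induction_on with
      | h0 => simp only [smul_zero, map_zero]
      | ht m c =>
        rw [rsmul_tmul, map_tmul, map_tmul, rid_tmul, rid_tmul, BimodHom.left_apply,
          BimodHom.map_rsmul, op_smul_eq_mul, MulOpposite.op_mul, mul_smul]
        rfl
      | ha x y hx hy => simp only [smul_add, map_add, hx, hy] }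

theorem counitMap_rTensor (f : M →ₗ[Rᵐᵒᵖ] M') (x : M ⊛[R] C) :
    counitMap R C M' (rTensor (B := R) C f x) = f (counitMap R C M x) := by
  refine Eq.trans ?_ (rid_map f _)
  exact congrArg (rid R M') (map_comm f (Coring.counit (R := R) (C := C)).left x).symm

end

/-- Left multiplication by an element of `R`, as a map of right modules `C → C`. -/
def lmul (C : Type u) [AddCommGroup C] [Module R C] [Module Rᵐᵒᵖ C]
    [SMulCommClass R Rᵐᵒᵖ C] (r : R) : C →ₗ[Rᵐᵒᵖ] C where
  toFun c := r • c
  map_add' := smul_add r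
  map_smul' s c := smul_comm r s c

/-- Left multiplication by an element of `R`, as a map of right comodules `C → C`. -/
def lmulHom (C : Type u) [AddCommGroup C] [Module R C] [Module Rᵐᵒᵖ C]
    [SMulCommClass R Rᵐᵒᵖ C] [Coring R C] (r : R) : self R C ⟶ self R C :=
  Hom.mk (M := self R C) (N := self R C) (lmul C r : C →ₗ[Rᵐᵒᵖ] C)
    fun (c : C) => by
      refine (Coring.comul.map_lsmul r c).trans ?_
      change r • Coring.comul (R := R) c = map _ _ (Coring.comul (R := R) c)
      generalize Coring.comul (R := R) c = z
      induction z using induction_on with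
      | h0 => simp only [map_zero, smul_zero]
      | ht a b => rfl
      | ha x y hx hy => simp only [map_add, smul_add, hx, hy]

/-- The coaction, as a map of comodules from `M` to the cofree comodule on `M`. -/
def coactHom (M : RightComodule R C) : M ⟶ cofree R C M :=
  Hom.mk (N := cofree R C M) M.coact fun m =>
    (AddEquiv.symm_apply_eq _).2 (M.coassoc m).symm

theorem coactHom_naturality {M M' : RightComodule R C} (f : M ⟶ M') :
    f ≫ coactHom M' = coactHom M ≫ cofreeMap C (Hom.toLinearMap f) :=
  hom_ext (Hom.colinear f)

theorem counitMap_coact (M : RightComodule R C) (m : M) : counitMap R C M (M.coact m) = m :=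
  M.counit m

theorem coactHom_cancel {M X : RightComodule R C} {f g : X ⟶ M}
    (h : f ≫ coactHom M = g ≫ coactHom M) : f = g :=
  hom_ext fun x => by
    have := congrArg (counitMap R C M) (hom_congr h x)
    exact (M.counit _).symm.trans (this.trans (M.counit _))

/-- The coaction `M → M ⊗_R C` is an equalizer of `ρ ⊗_R C` and `M ⊗_R Δ`: a colinear map
`g : X → M ⊗_R C` that equalizes them factors through it. The fork is split by the counit as a fork
of modules. -/
theorem exists_lift {M X : RightComodule R C} (g : X ⟶ cofree R C M)
    (hg : g ≫ cofreeMap C M.coact = g ≫ coactHom (cofree R C M)) :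
    ∃ f : X ⟶ M, f ≫ coactHom M = g := by
  have key (x : X) : M.coact (counitMap R C M (Hom.toLinearMap g x)) = Hom.toLinearMap g x := by
    have h := congrArg (counitMap R C (M ⊛[R] C)) (hom_congr hg x)
    refine Eq.trans ?_ (h.trans ((cofree R C M).counit _))
    exact (counitMap_rTensor M.coact (Hom.toLinearMap g x)).symm
  have hinj : Function.Injective
      (map M.coact LinearMap.id : M ⊛[R] C → (M ⊛[R] C) ⊛[R] C) := by
    refine Function.LeftInverse.injective (g := map (counitMap R C M) LinearMap.id) fun z => ?_
    rw [map_map, show (counitMap R C M).comp M.coact = LinearMap.id from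
      LinearMap.ext (counitMap_coact M)]
    exact map_id_id z
  refine ⟨Hom.mk ((counitMap R C M).comp (Hom.toLinearMap g)) fun x => hinj ?_, hom_ext key⟩
  rw [map_map, show M.coact.comp ((counitMap R C M).comp (Hom.toLinearMap g)) =
    Hom.toLinearMap g from LinearMap.ext key]
  refine Eq.trans ?_ (Hom.colinear g x)
  refine (hom_congr (coactHom_naturality (coactHom M)) _).symm.trans ?_
  exact congrArg (cofreeCoact R C M) (key x)

end RightComodule

/-! ### The comparison of `M ⊗_R GFC` with `GF(M ⊗_R C)` -/

namespace CoringHom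

open RightComodule

section

variable {R S : Type*} [Ring R] [Ring S] {φ : R →+* S} {C D : Type*}
  [AddCommGroup C] [Module R C] [Module Rᵐᵒᵖ C] [SMulCommClass R Rᵐᵒᵖ C] [Coring R C]
  [AddCommGroup D] [Module S D] [Module Sᵐᵒᵖ D] [SMulCommClass S Sᵐᵒᵖ D] [Coring S D]
  (Φ : CoringHom φ C D)

/-- If `M` preserves the equalizer, then `M ⊗_R GFC → M ⊗_R ((C ⊗_R S) ⊗_S (S ⊗_R C))` is
injective; `GFC` and the equalizer taken in left modules differ only in how they are encoded. -/
theorem GFC.map_incl_injective (M : Type*) [AddCommGroup M] [Module Rᵐᵒᵖ M]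
    (h : RightModulePreservesEqualizer M Φ.selfFst Φ.selfSnd) :
    Function.Injective (map (LinearMap.id : M →ₗ[Rᵐᵒᵖ] M) (GFC.incl Φ).left) := by
  let e : Φ.GFC →ₗ[R] LinearMap.eqLocus Φ.selfFst Φ.selfSnd :=
    { toFun := fun x => ⟨x.1, x.2⟩, map_add' := fun _ _ => rfl, map_smul' := fun _ _ => rfl }
  have he : Function.Injective (map (LinearMap.id : M →ₗ[Rᵐᵒᵖ] M) e) := by
    refine Function.LeftInverse.injective
      (g := map (LinearMap.id : M →ₗ[Rᵐᵒᵖ] M) (GFC.ofEqLocus Φ)) fun z => ?_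
    rw [map_map]
    exact map_id_id z
  have hc : ⇑(map (LinearMap.id : M →ₗ[Rᵐᵒᵖ] M) (GFC.incl Φ).left) =
      map (LinearMap.id : M →ₗ[Rᵐᵒᵖ] M) (LinearMap.eqLocus Φ.selfFst Φ.selfSnd).subtype ∘
        map (LinearMap.id : M →ₗ[Rᵐᵒᵖ] M) e := by
    funext z
    rw [Function.comp_apply, map_map]
    rfl
  rw [hc]
  exact h.1.comp he

theorem GFC.exists_map_incl_eq (M : Type*) [AddCommGroup M] [Module Rᵐᵒᵖ M]
    (h : RightModulePreservesEqualizer M Φ.selfFst Φ.selfSnd)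
    (y : M ⊛[R] ((C ⊛[R] LeftRes φ) ⊛[S] Φ.Ext))
    (hy : map LinearMap.id Φ.selfFst y = map LinearMap.id Φ.selfSnd y) :
    ∃ z, map (LinearMap.id : M →ₗ[Rᵐᵒᵖ] M) (GFC.incl Φ).left z = y := by
  obtain ⟨z, hz⟩ := (h.2 y).2 hy
  refine ⟨map (LinearMap.id : M →ₗ[Rᵐᵒᵖ] M) (GFC.ofEqLocus Φ) z, ?_⟩
  rw [map_map, ← hz]
  rfl

end

section

variable {R S : Type u} [Ring R] [Ring S] {φ : R →+* S} {C : Type u} [AddCommGroup C] [Module R C]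
  [Module Rᵐᵒᵖ C] [SMulCommClass R Rᵐᵒᵖ C] {M : Type u} [AddCommGroup M] [Module Rᵐᵒᵖ M]
  {P : Type u} [AddCommGroup P] [Module S P]

/-- The isomorphism `M ⊗_R ((C ⊗_R S) ⊗_S P) ≅ ((M ⊗_R C) ⊗_R S) ⊗_S P`. -/
def assocSelf (φ : R →+* S) (C : Type u) [AddCommGroup C] [Module R C] [Module Rᵐᵒᵖ C]
    [SMulCommClass R Rᵐᵒᵖ C] (M : Type u) [AddCommGroup M] [Module Rᵐᵒᵖ M] (P : Type u)
    [AddCommGroup P] [Module S P] :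
    M ⊛[R] ((C ⊛[R] LeftRes φ) ⊛[S] P) ≃+ ((M ⊛[R] C) ⊛[R] LeftRes φ) ⊛[S] P :=
  (assoc R S M (C ⊛[R] LeftRes φ) P).symm.trans <|
    AddMonoidHom.toAddEquiv
      (map { (assoc R R M C (LeftRes φ)).symm with
        map_smul' := fun s x => assoc_symm_rsmul s.unop x } LinearMap.id)
      (map { assoc R R M C (LeftRes φ) with
        map_smul' := fun s x => assoc_rsmul s.unop x } LinearMap.id)
      (addHom_ext fun x p =>
        congrArg (fun y => tmul S y p) ((assoc R R M C (LeftRes φ)).apply_symm_apply x))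
      (addHom_ext fun x p =>
        congrArg (fun y => tmul S y p) ((assoc R R M C (LeftRes φ)).symm_apply_apply x))

theorem assocSelf_tmul (m : M) (x : (C ⊛[R] LeftRes φ) ⊛[S] P) :
    assocSelf φ C M P (tmul R m x) =
      map (rTensor (B := S) (LeftRes φ) (RightComodule.insert m)) LinearMap.id x := by
  refine DFunLike.congr_fun (addHom_ext₃
    (f := (assocSelf φ C M P).toAddMonoidHom.comp
      (AddMonoidHom.mk' (fun x => tmul R m x) fun _ _ => tmul_add _ _ _))
    (g := map (rTensor (B := S) (LeftRes φ) (RightComodule.insert m)) LinearMap.id)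
    fun _ _ _ => rfl) x

end

variable {R S : Type u} [Ring R] [Ring S] {φ : R →+* S} {C D : Type u}
  [AddCommGroup C] [Module R C] [Module Rᵐᵒᵖ C] [SMulCommClass R Rᵐᵒᵖ C] [Coring R C]
  [AddCommGroup D] [Module S D] [Module Sᵐᵒᵖ D] [SMulCommClass S Sᵐᵒᵖ D] [Coring S D]
  (Φ : CoringHom φ C D)

/-- Up to associativity the left coaction of `(C ⊗_R S) ⊗_S (S ⊗_R C)` is
`(Δ ⊗_R S) ⊗_S (S ⊗_R C)`. -/
theorem assocSelf_tensorLeftCoact (x : (C ⊛[R] LeftRes φ) ⊛[S] Φ.Ext) :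
    assocSelf φ C C Φ.Ext (Φ.tensorLeftCoact x) =
      map (rTensor (B := S) (LeftRes φ) (Coring.comul (R := R) (C := C)).right) LinearMap.id
        x := by
  refine addHom_congr (f := (assocSelf φ C C Φ.Ext).toAddMonoidHom.comp
      Φ.tensorLeftCoact.toAddMonoidHom)
    (g := map (rTensor (B := S) (LeftRes φ) (Coring.comul (R := R) (C := C)).right)
      LinearMap.id) (fun y l => ?_) x
  change map _ _ ((assoc R S C (C ⊛[R] LeftRes φ) Φ.Ext).symm
    (assoc R S C (C ⊛[R] LeftRes φ) Φ.Ext (map selfLeftCoact LinearMap.id (tmul S y l)))) = _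
  rw [AddEquiv.symm_apply_apply]
  exact congrArg (fun z => tmul S z l) ((assoc R R C C (LeftRes φ)).symm_apply_apply _)

variable (h : ∀ N : RightComodule S D,
  LeftModulePreservesEqualizer (C ⊛[R] C) (Φ.cotensorFst N.coact) (Φ.cotensorSnd N))

/-- The composition `GF` of the induction functor and its right adjoint. -/
abbrev inductionMonad : RightComodule R C ⥤ RightComodule R C :=
  inductionFunctor Φ ⋙ Φ.cotensorFunctor h

section Comparison

variable (M : Type u) [AddCommGroup M] [Module Rᵐᵒᵖ M]

theorem assocSelf_mem_cotensor (z : M ⊛[R] Φ.GFC) :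
    assocSelf φ C M Φ.Ext (map LinearMap.id (GFC.incl Φ).left z) ∈
      Φ.cotensor (Φ.indCoact (cofreeCoact R C M)) := by
  induction z using induction_on with
  | h0 => simp only [map_zero, zero_mem]
  | ht m x =>
    rw [map_tmul, LinearMap.id_apply, assocSelf_tmul]
    exact Φ.map_mem_cotensor _
      (Φ.indCoact_natural _ (cofreeCoact R C M) _ (cofreeCoact_tmul (C := C) m)) x.2
  | ha x y hx hy =>
    rw [map_add, map_add]
    exact add_mem hx hy

/-- The comparison map `M ⊗_R GFC → GF(M ⊗_R C)` given by
`m ⊗ ((c ⊗ s) ⊗ l) ↦ ((m ⊗ c) ⊗ s) ⊗ l`. -/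
def comparison : M ⊛[R] Φ.GFC →ₗ[Rᵐᵒᵖ] Φ.cotensor (Φ.indCoact (cofreeCoact R C M)) where
  toFun z := ⟨_, Φ.assocSelf_mem_cotensor M z⟩
  map_add' x y := Subtype.ext <| by
    change assocSelf φ C M Φ.Ext (map LinearMap.id (GFC.incl Φ).left (x + y)) = _
    rw [map_add, map_add]
    rfl
  map_smul' r z := Subtype.ext <| by
    obtain ⟨r, rfl⟩ := MulOpposite.op_surjective r
    change assocSelf φ C M Φ.Ext (map LinearMap.id (GFC.incl Φ).left (z <• r)) =
      assocSelf φ C M Φ.Ext (map LinearMap.id (GFC.incl Φ).left z) <• r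
    induction z using induction_on with
    | h0 => simp only [map_zero, smul_zero]
    | ht m x =>
      rw [rsmul_tmul, map_tmul, map_tmul, assocSelf_tmul, assocSelf_tmul]
      exact (rTensor (B := R) Φ.Ext (rTensor (B := S) (LeftRes φ)
        (RightComodule.insert m))).map_smul (MulOpposite.op r) (GFC.incl Φ x)
    | ha x y hx hy => simp only [smul_add, map_add, hx, hy]

variable {M}

theorem comparison_coe (z : M ⊛[R] Φ.GFC) : (Φ.comparison M z).1 =
    assocSelf φ C M Φ.Ext (map LinearMap.id (GFC.incl Φ).left z) := rfl

theorem comparison_tmul (m : M) (x : Φ.GFC) : Φ.comparison M (tmul R m x) =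
    Hom.toLinearMap ((Φ.inductionMonad h).map (insertHom C m)) x :=
  Subtype.ext (assocSelf_tmul m (GFC.incl Φ x))

/-- The left coaction of `GFC` is `GF(Δ) : GFC → GF(C ⊗_R C)` up to the comparison map. -/
theorem map_coactHom_self (hl : RightModulePreservesEqualizer C Φ.selfFst Φ.selfSnd)
    (x : Φ.GFC) :
    Hom.toLinearMap ((Φ.inductionMonad h).map (coactHom (self R C))) x =
      Φ.comparison C (GFC.leftCoact Φ hl x) :=
  Subtype.ext <| by
    rw [comparison_coe, GFC.leftCoact_spec, assocSelf_tensorLeftCoact]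
    rfl

/-- If `M` preserves the equalizer defining `GFC`, then `M ⊗_R GFC ≅ GF(M ⊗_R C)`. -/
theorem comparison_bijective (hM : RightModulePreservesEqualizer M Φ.selfFst Φ.selfSnd) :
    Function.Bijective (Φ.comparison M) := by
  have hfst (w : M ⊛[R] ((C ⊛[R] LeftRes φ) ⊛[S] Φ.Ext)) :
      assocSelf φ C M (D ⊛[S] Φ.Ext) (map LinearMap.id Φ.selfFst w) =
      Φ.cotensorFst (Φ.indCoact (cofreeCoact R C M)) (assocSelf φ C M Φ.Ext w) := by
    induction w using induction_on with
    | h0 => simp only [map_zero]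
    | ht m x =>
      rw [map_tmul, assocSelf_tmul, LinearMap.id_apply, assocSelf_tmul]
      exact (Φ.cotensorFst_map _
        (Φ.indCoact_natural _ (cofreeCoact R C M) _ (cofreeCoact_tmul (C := C) m)) x).symm
    | ha x y hx hy => simp only [map_add, hx, hy]
  have hsnd (w : M ⊛[R] ((C ⊛[R] LeftRes φ) ⊛[S] Φ.Ext)) :
      assocSelf φ C M (D ⊛[S] Φ.Ext) (map LinearMap.id Φ.selfSnd w) =
      Φ.cotensorSnd _ (assocSelf φ C M Φ.Ext w) := by
    induction w using induction_on with
    | h0 => simp only [map_zero]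
    | ht m x =>
      rw [map_tmul, assocSelf_tmul, LinearMap.id_apply, assocSelf_tmul]
      exact map_comm _ Φ.extLeftCoact.left x
    | ha x y hx hy => simp only [map_add, hx, hy]
  refine ⟨fun y z hyz => ?_, fun y => ?_⟩
  · exact GFC.map_incl_injective Φ M hM
      ((assocSelf φ C M Φ.Ext).injective (congrArg Subtype.val hyz))
  · obtain ⟨w, hw⟩ := (assocSelf φ C M Φ.Ext).surjective y.1
    obtain ⟨z, rfl⟩ := GFC.exists_map_incl_eq Φ M hM w (by
      apply (assocSelf φ C M (D ⊛[S] Φ.Ext)).injective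
      rw [hfst, hsnd, hw]
      exact y.2)
    exact ⟨z, Subtype.ext hw⟩

/-- A colinear map on `GF(M ⊗_R C)` is determined by its values on the images of `GFC` under the
maps `GF(m ⊗ -)`. -/
theorem inductionMonad_cofree_ext (hM : RightModulePreservesEqualizer M Φ.selfFst Φ.selfSnd)
    {X : RightComodule R C} {f g : (Φ.inductionMonad h).obj (cofree R C M) ⟶ X}
    (hfg : ∀ m, (Φ.inductionMonad h).map (insertHom C m) ≫ f =
      (Φ.inductionMonad h).map (insertHom C m) ≫ g) : f = g := by
  refine hom_ext fun y => ?_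
  obtain ⟨z, rfl⟩ := (Φ.comparison_bijective hM).2 y
  refine DFunLike.congr_fun (addHom_ext
    (f := (Hom.toLinearMap f).toAddMonoidHom.comp (Φ.comparison M).toAddMonoidHom)
    (g := (Hom.toLinearMap g).toAddMonoidHom.comp (Φ.comparison M).toAddMonoidHom)
    fun m x => ?_) z
  exact (congrArg (Hom.toLinearMap f) (Φ.comparison_tmul h m x)).trans
    ((hom_congr (hfg m) x).trans
      (congrArg (Hom.toLinearMap g) (Φ.comparison_tmul h m x)).symm)

/-- A map `f` with `f ∘ GF(m ⊗ -) = m ⊗ ν(-)` for all `m` is `M ⊗_R ν` along the comparison map. -/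
theorem apply_comparison
    (f : (Φ.inductionMonad h).obj (cofree R C M) ⟶ cofree R C M) (ν : BimodHom R R Φ.GFC C)
    (hf : ∀ (m : M) (x : Φ.GFC),
      Hom.toLinearMap f (Hom.toLinearMap ((Φ.inductionMonad h).map (insertHom C m)) x) =
        tmul R m (ν x)) (z : M ⊛[R] Φ.GFC) :
    Hom.toLinearMap f (Φ.comparison M z) = map LinearMap.id ν.left z :=
  DFunLike.congr_fun (addHom_ext
    (f := (Hom.toLinearMap f).toAddMonoidHom.comp (Φ.comparison M).toAddMonoidHom)
    (g := map LinearMap.id ν.left)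
    fun m x => (congrArg (Hom.toLinearMap f) (Φ.comparison_tmul h m x)).trans (hf m x)) z

end Comparison

/-! ### From a natural section of the unit to a bicomodule map -/

section Forward

variable (ν : Φ.inductionMonad h ⟶ 𝟭 (RightComodule R C))

/-- The component at `C` of a natural transformation `GF → id`. It is left `R`-linear, because the
left multiplications are endomorphisms of the right comodule `C`. -/
def componentSelf : BimodHom R R Φ.GFC C where
  toFun := (Hom.toLinearMap (ν.app (self R C))).toAddMonoidHom
  map_lsmul r x := by
    have hr : Hom.toLinearMap ((Φ.inductionMonad h).map (lmulHom C r)) x = r • x :=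
      GFC.incl_injective Φ <| DFunLike.congr_fun (addHom_ext₃
        (f := map (rTensor (B := S) (LeftRes φ) (lmul C r)) (LinearMap.id : Φ.Ext →ₗ[S] Φ.Ext))
        (g := lsmulHom r) fun _ _ _ => rfl) (GFC.incl Φ x)
    have hn := hom_congr (ν.naturality (lmulHom C r)) x
    exact (congrArg (Hom.toLinearMap (ν.app (self R C))) hr).symm.trans hn
  map_rsmul x r := (Hom.toLinearMap (ν.app (self R C))).map_smul (MulOpposite.op r) x

/-- The component at `C` of a natural transformation `GF → id` is a map of bicomodules: left
colinearity is naturality at `Δ : C → C ⊗_R C`, with values in the cofree comodule. -/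
theorem componentSelf_isBicolinear (hl : RightModulePreservesEqualizer C Φ.selfFst Φ.selfSnd) :
    IsBicolinearToSelf (GFC.rightCoact Φ (h ((self R C).induce Φ)).of_tensor)
      (GFC.leftCoact Φ hl) (Φ.componentSelf h ν) where
  right_colinear x := Hom.colinear (ν.app (self R C)) x
  left_colinear x := by
    have hn := hom_congr (ν.naturality (coactHom (self R C))) x
    refine hn.symm.trans ?_
    refine (congrArg (Hom.toLinearMap (ν.app (cofree R C C)))
      (Φ.map_coactHom_self h hl x)).trans ?_
    exact Φ.apply_comparison h (ν.app (cofree R C C))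
      (Φ.componentSelf h ν) (fun c y => hom_congr (ν.naturality (insertHom C c)) y) _

end Forward

/-! ### From a bicomodule map to a natural section of the unit -/

section Backward

variable (ν : BimodHom R R Φ.GFC C)

section Cofree

variable {M M' : Type u} [AddCommGroup M] [Module Rᵐᵒᵖ M] [AddCommGroup M'] [Module Rᵐᵒᵖ M']

/-- The map `GF(M ⊗_R C) ≅ M ⊗_R GFC → M ⊗_R C` of right modules given by `M ⊗_R ν`. -/
def cofreeSectionLinear (hM : RightModulePreservesEqualizer M Φ.selfFst Φ.selfSnd) :
    Φ.cotensor (Φ.indCoact (cofreeCoact R C M)) →ₗ[Rᵐᵒᵖ] M ⊛[R] C :=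
  ({ map LinearMap.id ν.left with
      map_smul' := fun r x => BalTensor.map_rsmul _ _ r.unop (fun y => ν.map_rsmul y _) x } :
      M ⊛[R] Φ.GFC →ₗ[Rᵐᵒᵖ] M ⊛[R] C).comp
    (LinearEquiv.ofBijective (Φ.comparison M) (Φ.comparison_bijective hM)).symm.toLinearMap

theorem cofreeSectionLinear_comparison
    (hM : RightModulePreservesEqualizer M Φ.selfFst Φ.selfSnd) (z : M ⊛[R] Φ.GFC) :
    Φ.cofreeSectionLinear ν hM (Φ.comparison M z) = map LinearMap.id ν.left z := by
  change map LinearMap.id ν.left ((LinearEquiv.ofBijective (Φ.comparison M)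
    (Φ.comparison_bijective hM)).symm (LinearEquiv.ofBijective (Φ.comparison M)
    (Φ.comparison_bijective hM) z)) = _
  rw [LinearEquiv.symm_apply_apply]

theorem cofreeSectionLinear_colinear
    (hν : ∀ x, Coring.comul (R := R) (ν x) = map ν.right LinearMap.id
      (GFC.rightCoact Φ (h ((self R C).induce Φ)).of_tensor x))
    (hM : RightModulePreservesEqualizer M Φ.selfFst Φ.selfSnd)
    (y : Φ.cotensor (Φ.indCoact (cofreeCoact R C M))) :
    cofreeCoact R C M (Φ.cofreeSectionLinear ν hM y) =
      map (Φ.cofreeSectionLinear ν hM) LinearMap.id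
        (Φ.cotensorRightCoact (Φ.indCoact (cofreeCoact R C M))
          (h ((cofree R C M).induce Φ)).of_tensor y) := by
  obtain ⟨z, rfl⟩ := (Φ.comparison_bijective hM).2 y
  induction z using induction_on with
  | h0 => simp only [map_zero]
  | ht m x =>
    rw [cofreeSectionLinear_comparison, map_tmul, LinearMap.id_apply, BimodHom.left_apply,
      cofreeCoact_tmul, hν, Φ.comparison_tmul h, map_map]
    refine Eq.trans ?_ (congrArg (map (Φ.cofreeSectionLinear ν hM) LinearMap.id)
      (Hom.colinear ((Φ.inductionMonad h).map (insertHom C m)) x).symm)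
    refine Eq.trans ?_ (map_map (Hom.toLinearMap ((Φ.inductionMonad h).map (insertHom C m)))
      LinearMap.id (Φ.cofreeSectionLinear ν hM) LinearMap.id
      (GFC.rightCoact Φ (h ((self R C).induce Φ)).of_tensor x)).symm
    refine congrArg (fun f => map f LinearMap.id
      (GFC.rightCoact Φ (h ((self R C).induce Φ)).of_tensor x)) (LinearMap.ext fun y => ?_)
    refine Eq.trans ?_ (congrArg (Φ.cofreeSectionLinear ν hM) (Φ.comparison_tmul h m y))
    rw [cofreeSectionLinear_comparison]
    rfl
  | ha x y hx hy => simp only [map_add, hx, hy]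

variable {ν}
  (hν : ∀ x, Coring.comul (R := R) (ν x) = map ν.right LinearMap.id
    (GFC.rightCoact Φ (h ((self R C).induce Φ)).of_tensor x))

/-- The map `GF(M ⊗_R C) ≅ M ⊗_R GFC → M ⊗_R C` of right comodules given by `M ⊗_R ν`. -/
def cofreeSection (hM : RightModulePreservesEqualizer M Φ.selfFst Φ.selfSnd) :
    (Φ.inductionMonad h).obj (cofree R C M) ⟶ cofree R C M :=
  Hom.mk (M := (Φ.inductionMonad h).obj (cofree R C M)) (N := cofree R C M)
    (Φ.cofreeSectionLinear ν hM) (Φ.cofreeSectionLinear_colinear h ν hν hM)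

theorem cofreeSection_map_insertHom
    (hM : RightModulePreservesEqualizer M Φ.selfFst Φ.selfSnd) (m : M) (x : Φ.GFC) :
    Hom.toLinearMap ((Φ.inductionMonad h).map (insertHom C m) ≫ Φ.cofreeSection h hν hM) x =
      tmul R m (ν x) :=
  (congrArg (Φ.cofreeSectionLinear ν hM) (Φ.comparison_tmul h m x).symm).trans
    (Φ.cofreeSectionLinear_comparison ν hM _)

theorem cofreeSection_naturality (hM : RightModulePreservesEqualizer M Φ.selfFst Φ.selfSnd)
    (hM' : RightModulePreservesEqualizer M' Φ.selfFst Φ.selfSnd) (f : M →ₗ[Rᵐᵒᵖ] M') :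
    (Φ.inductionMonad h).map (cofreeMap C f) ≫ Φ.cofreeSection h hν hM' =
      Φ.cofreeSection h hν hM ≫ cofreeMap C f := by
  refine Φ.inductionMonad_cofree_ext h hM fun m => ?_
  rw [← Functor.map_comp_assoc, insertHom_comp_cofreeMap, ← Category.assoc]
  refine hom_ext fun x => (Φ.cofreeSection_map_insertHom h hν hM' (f m) x).trans ?_
  exact (congrArg (rTensor (B := R) C f) (Φ.cofreeSection_map_insertHom h hν hM m x)).symm

/-- The section at `M ⊗_R C` commutes with `M ⊗_R Δ`, because `ν` is left colinear. -/
theorem cofreeSection_coactHom (hM : RightModulePreservesEqualizer M Φ.selfFst Φ.selfSnd)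
    (hC : RightModulePreservesEqualizer C Φ.selfFst Φ.selfSnd)
    (hMC : RightModulePreservesEqualizer (M ⊛[R] C) Φ.selfFst Φ.selfSnd)
    (hν' : ∀ x, Coring.comul (R := R) (ν x) = map LinearMap.id ν.left (GFC.leftCoact Φ hC x)) :
    (Φ.inductionMonad h).map (coactHom (cofree R C M)) ≫ Φ.cofreeSection h hν hMC =
      Φ.cofreeSection h hν hM ≫ coactHom (cofree R C M) := by
  have hself (x : Φ.GFC) :
      Hom.toLinearMap ((Φ.inductionMonad h).map (coactHom (self R C)) ≫
        Φ.cofreeSection h hν hC) x = Coring.comul (R := R) (ν x) :=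
    (congrArg (Φ.cofreeSectionLinear ν hC) (Φ.map_coactHom_self h hC x)).trans
      ((Φ.cofreeSectionLinear_comparison ν hC _).trans (hν' x).symm)
  refine Φ.inductionMonad_cofree_ext h hM fun m => ?_
  rw [← Functor.map_comp_assoc, coactHom_naturality, Functor.map_comp_assoc]
  refine (congrArg ((Φ.inductionMonad h).map (coactHom (self R C)) ≫ ·)
    (Φ.cofreeSection_naturality h hν hC hMC
      (RightComodule.insert m : C →ₗ[Rᵐᵒᵖ] M ⊛[R] C))).trans ?_
  refine hom_ext fun x => (congrArg (rTensor (B := R) C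
    (RightComodule.insert m : C →ₗ[Rᵐᵒᵖ] M ⊛[R] C)) (hself x)).trans ?_
  refine Eq.trans ?_
    (congrArg (cofreeCoact R C M) (Φ.cofreeSection_map_insertHom h hν hM m x)).symm
  exact (cofreeCoact_tmul (C := C) m (ν x)).symm

/-- On the image of `m ⊗ GFC` this is `η ∘ ν = id` on `GFC`, by naturality of the unit at
`c ↦ m ⊗ c`. -/
theorem cofreeSection_unit (hM : RightModulePreservesEqualizer M Φ.selfFst Φ.selfSnd)
    (hu : ∀ x : Φ.GFC, Φ.unit (ν x) = x) :
    Φ.cofreeSection h hν hM ≫ (Φ.inductionAdjunction h).unit.app (cofree R C M) = 𝟙 _ := by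
  refine Φ.inductionMonad_cofree_ext h hM fun m => ?_
  rw [Category.comp_id, ← Category.assoc]
  have hn (c : C) := hom_congr ((Φ.inductionAdjunction h).unit.naturality (insertHom C m)) c
  refine hom_ext fun x => ?_
  refine (congrArg (Hom.toLinearMap ((Φ.inductionAdjunction h).unit.app (cofree R C M)))
    (Φ.cofreeSection_map_insertHom h hν hM m x)).trans ?_
  refine (hn (ν x)).trans ?_
  exact congrArg (Hom.toLinearMap ((Φ.inductionMonad h).map (insertHom C m)))
    ((Φ.inductionAdjunction_unit_self h (ν x)).trans (hu x))

end Cofree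

/-- `GF` preserves the monomorphism `M → M ⊗_R C`, which splits as a map of modules. -/
theorem map_coactHom_cancel {M X : RightComodule R C} {f g : X ⟶ (Φ.inductionMonad h).obj M}
    (hfg : f ≫ (Φ.inductionMonad h).map (coactHom M) =
      g ≫ (Φ.inductionMonad h).map (coactHom M)) : f = g := by
  refine hom_ext fun x => Subtype.ext ?_
  have hinj : Function.Injective
      (map (rTensor (B := S) (LeftRes φ) M.coact) (LinearMap.id : Φ.Ext →ₗ[S] Φ.Ext)) := by
    refine Function.LeftInverse.injective
      (g := map (rTensor (B := S) (LeftRes φ) (counitMap R C M)) LinearMap.id) fun z => ?_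
    refine DFunLike.congr_fun (addHom_ext₃
      (f := (map (rTensor (B := S) (LeftRes φ) (counitMap R C M)) LinearMap.id).comp
        (map (rTensor (B := S) (LeftRes φ) M.coact) LinearMap.id))
      (g := AddMonoidHom.id _) fun m s l => ?_) z
    exact congrArg (fun m => tmul S (tmul R m s) l) (counitMap_coact M m)
  exact hinj (congrArg Subtype.val (hom_congr hfg x))

/-- A section of the unit on cofree comodules extends to all comodules, since
`M → M ⊗_R C` is an equalizer of maps of cofree comodules. -/
theorem exists_unitSection_of_cofree
    (θ : ∀ M : RightComodule R C, (Φ.inductionMonad h).obj (cofree R C M) ⟶ cofree R C M)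
    (hnat : ∀ {M M' : RightComodule R C} (f : M →ₗ[Rᵐᵒᵖ] M'),
      (Φ.inductionMonad h).map (cofreeMap C f) ≫ θ M' = θ M ≫ cofreeMap C f)
    (hcoact : ∀ M : RightComodule R C,
      (Φ.inductionMonad h).map (coactHom (cofree R C M)) ≫ θ (cofree R C M) =
      θ M ≫ coactHom (cofree R C M))
    (hunit : ∀ M : RightComodule R C, θ M ≫ (Φ.inductionAdjunction h).unit.app (cofree R C M) = 𝟙 _) :
    ∃ τ : Φ.inductionMonad h ⟶ 𝟭 (RightComodule R C),
      ∀ M, τ.app M ≫ (Φ.inductionAdjunction h).unit.app M = 𝟙 _ := by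
  have hlift (M : RightComodule R C) :
      ∃ τ : (Φ.inductionMonad h).obj M ⟶ M,
        τ ≫ coactHom M = (Φ.inductionMonad h).map (coactHom M) ≫ θ M := by
    let k : cofree R C M ⟶ cofree R C (cofree R C M) := cofreeMap C M.coact
    have hc : coactHom M ≫ coactHom (cofree R C M) = coactHom M ≫ k :=
      coactHom_naturality (coactHom M)
    have hn : (Φ.inductionMonad h).map k ≫ θ (cofree R C M) = θ M ≫ k :=
      hnat (M := M) (M' := cofree R C M) M.coact
    refine exists_lift _ ?_
    change (_ ≫ θ M) ≫ k = _
    rw [Category.assoc, Category.assoc, ← hcoact, ← Functor.map_comp_assoc, hc,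
      Functor.map_comp_assoc, hn]
  choose τ hτ using hlift
  have hτnat {M M' : RightComodule R C} (f : M ⟶ M') :
      (Φ.inductionMonad h).map f ≫ τ M' = τ M ≫ f := by
    refine coactHom_cancel ?_
    rw [Category.assoc, hτ, ← Functor.map_comp_assoc, Category.assoc, coactHom_naturality,
      Functor.map_comp_assoc, hnat, ← Category.assoc, ← hτ, Category.assoc]
  refine ⟨{ app := τ, naturality := fun M M' f => hτnat f }, fun M => ?_⟩
  apply Φ.map_coactHom_cancel h
  have hn : coactHom M ≫ (Φ.inductionAdjunction h).unit.app (cofree R C M) =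
      (Φ.inductionAdjunction h).unit.app M ≫ (Φ.inductionMonad h).map (coactHom M) :=
    (Φ.inductionAdjunction h).unit.naturality (coactHom M)
  change (τ M ≫ _) ≫ _ = 𝟙 _ ≫ _
  refine (Category.assoc _ _ _).trans ((congrArg (τ M ≫ ·) hn.symm).trans ?_)
  refine (Category.assoc _ _ _).symm.trans ((congrArg (· ≫ _) (hτ M)).trans ?_)
  refine (Category.assoc _ _ _).trans ((congrArg (_ ≫ ·) (hunit M)).trans ?_)
  exact (Category.comp_id _).trans (Category.id_comp _).symm

end Backward

end CoringHom

end

theorem theorem3p20 {R S : Type u} [Ring R] [Ring S] {φ : R →+* S} {C D : Type u}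
    [AddCommGroup C] [Module R C] [Module Rᵐᵒᵖ C] [SMulCommClass R Rᵐᵒᵖ C] [Coring R C]
    [AddCommGroup D] [Module S D] [Module Sᵐᵒᵖ D] [SMulCommClass S Sᵐᵒᵖ D] [Coring S D]
    (Φ : CoringHom φ C D)
    (h₁ : ∀ N : RightComodule S D,
      LeftModulePreservesEqualizer (C ⊛[R] C) (Φ.cotensorFst N.coact) (Φ.cotensorSnd N))
    (h₂ : ∀ M : RightComodule R C, RightModulePreservesEqualizer M Φ.selfFst Φ.selfSnd) :
    NaturallyFull (inductionFunctor Φ) ↔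
      ∃ ν : BimodHom R R Φ.GFC C,
        IsBicolinearToSelf
          (CoringHom.GFC.rightCoact Φ (h₁ ((RightComodule.self R C).induce Φ)).of_tensor)
          (CoringHom.GFC.leftCoact Φ (h₂ (RightComodule.self R C))) ν ∧
        ∀ x : Φ.GFC, Φ.unit (ν x) = x := by
  rw [naturallyFull_iff_of_adjunction (Φ.inductionAdjunction h₁)]
  constructor
  · rintro ⟨ν, hν⟩
    exact ⟨Φ.componentSelf h₁ ν,
      Φ.componentSelf_isBicolinear h₁ ν (h₂ (RightComodule.self R C)),
      fun x => RightComodule.hom_congr (hν (RightComodule.self R C)) x⟩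
  · rintro ⟨ν, hν, hu⟩
    have hr : ∀ x, Coring.comul (R := R) (ν x) = BalTensor.map ν.right LinearMap.id
        (CoringHom.GFC.rightCoact Φ (h₁ ((RightComodule.self R C).induce Φ)).of_tensor x) :=
      hν.right_colinear
    exact Φ.exists_unitSection_of_cofree h₁ (fun M => Φ.cofreeSection h₁ hr (h₂ M))
      (fun {M M'} f => Φ.cofreeSection_naturality h₁ hr (h₂ M) (h₂ M') f)
      (fun M => Φ.cofreeSection_coactHom h₁ hr (h₂ M) (h₂ (RightComodule.self R C))
        (h₂ (RightComodule.cofree R C M)) hν.left_colinear)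
      (fun M => Φ.cofreeSection_unit h₁ hr (h₂ M) hu)
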